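/- **Theorem (conditional on Conjecture H).** *Notation.* For a finite set $\mathcal{H}$ of $k$ distinct integers, let $\pi(x;\mathcal{H})$ be the number of positive integers $n\le x$ such that $n+a$ is a prime number for every $a\in\mathcal{H}$. For a prime $p$ let $\nu_{\mathcal{H}}(p)$ be the number of distinct residue classes modulo $p$ occupied by the elements of $\mathcal{H}$, call $\mathcal{H}$ admissible if $\nu_{\mathcal{H}}(p)<p$ for all primes $p$, and put $$\mathfrak{S}(\mathcal{H})=\prod_{p}\Bigl(1-\frac1p\Bigr)^{-k}\Bigl(1-\frac{\nu_{\mathcal{H}}(p)}{p}\Bigr).$$ *Conjecture H.* For each fixed integer $k\ge 2$, each constant $\lambda>0$ and each function $h$ with $h(x)\sim\lambda\log x$ as $x\to\infty$, $$\pi(x;\mathcal{H})=\mathfrak{S}(\mathcal{H})\,\frac{x}{(\log x)^k}\,(1+o(1))\qquad(x\to\infty),$$ uniformly over all admissible $k$-element sets of integers $\mathcal{H}\subset[1,h(x)]$. *Statement.* Assume Conjecture H. For a positive integer $d$ let $$\mathfrak{S}(d)=2C_2\prod_{\substack{p\mid d\\ p>2}}\frac{p-1}{p-2}\ \text{ if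 } d \text{ is even},\qquad \mathfrak{S}(d)=0\ \text{ if } d\text{ is odd},\qquad C_2=\prod_{p>2}\Bigl(1-\frac{1}{(p-1)^2}\Bigr),$$ where $p$ runs over primes, and let $N(x,d)$ be the number of $n$ with $p_{n+1}\le x$ and $p_{n+1}-p_n=d$, where $p_n$ is the $n$th prime. Then for every constant $\lambda>0$ and every choice of even integers $d=d(x)$ with $d\sim\lambda\log x$ as $x\to\infty$, $$N(x,d)\sim e^{-\lambda}\,\mathfrak{S}(d)\,\frac{x}{(\log x)^2}\qquad(x\to\infty).$$ -/

import Mathlib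

open Filter Asymptotics

namespace PrimeTuples

noncomputable section

/-- The number of distinct residue classes modulo `p` occupied by the elements of `H`. -/
def residueCount (H : Finset ℤ) (p : ℕ) : ℕ :=
  (H.image (fun a : ℤ => (a : ZMod p))).card

/-- `H` is admissible if, for every prime `p`, it misses some residue class modulo `p`. -/
def Admissible (H : Finset ℤ) : Prop :=
  ∀ p : ℕ, p.Prime → residueCount H p < p

/-- The number of positive integers `n ≤ x` such that all the integers `n + a`, `a ∈ H`,
are prime numbers (positive primes). -/
def tupleCount (x : ℝ) (H : Finset ℤ) : ℕ :=
  {n : ℕ | 1 ≤ n ∧ (n : ℝ) ≤ x ∧ ∀ a ∈ H, ∃ p : ℕ, p.Prime ∧ (n : ℤ) + a = (p : ℤ)}.ncard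

/-- The singular series of a finite set `H` of integers, a product over all primes. -/
def tupleSingularSeries (H : Finset ℤ) : ℝ :=
  ∏' p : Nat.Primes,
    ((1 - 1 / ((p : ℕ) : ℝ)) ^ H.card)⁻¹ * (1 - (residueCount H (p : ℕ) : ℝ) / ((p : ℕ) : ℝ))

/-- The uniform prime `k`-tuple conjecture: for every fixed `k ≥ 2`, every constant `lam > 0` and
every `h` with `h(x) ~ lam * log x`, the count of prime tuples equals the singular series times
`x / (log x)^k` times `1 + o(1)`, uniformly for admissible `k`-element sets `H ⊆ [1, h(x)]`. -/
def ConjectureH : Prop :=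
  ∀ k : ℕ, 2 ≤ k → ∀ lam : ℝ, 0 < lam → ∀ h : ℝ → ℝ,
    h ~[atTop] (fun x : ℝ => lam * Real.log x) →
    ∀ ε : ℝ, 0 < ε → ∀ᶠ x : ℝ in atTop,
      ∀ H : Finset ℤ, H.card = k → Admissible H → (∀ a ∈ H, 1 ≤ a ∧ (a : ℝ) ≤ h x) →
        |(tupleCount x H : ℝ) - tupleSingularSeries H * (x / Real.log x ^ k)|
          ≤ ε * (tupleSingularSeries H * (x / Real.log x ^ k))

/-- The twin prime constant, a product over all primes `p > 2`. -/
def twinPrimeConstant : ℝ :=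
  ∏' p : {p : ℕ // p.Prime ∧ 2 < p}, (1 - 1 / (((p : ℕ) : ℝ) - 1) ^ 2)

/-- The singular series for prime pairs with difference `d`, for a positive integer `d`. -/
def pairSingularSeries (d : ℕ) : ℝ :=
  if Even d then
    2 * twinPrimeConstant *
      ∏ p ∈ d.primeFactors with 2 < p, ((p : ℝ) - 1) / ((p : ℝ) - 2)
  else 0

/-- The number of pairs of consecutive primes with difference `d`, the larger being at most `x`.
Here `Nat.nth Nat.Prime n` enumerates the primes in increasing order, starting with `2` at
`n = 0`. -/
def consecutiveCount (x : ℝ) (d : ℕ) : ℕ :=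
  {n : ℕ | (Nat.nth Nat.Prime (n + 1) : ℝ) ≤ x ∧
    (Nat.nth Nat.Prime (n + 1) : ℤ) - (Nat.nth Nat.Prime n : ℤ) = (d : ℤ)}.ncard

end

end PrimeTuples

/-! Shift so that a prime pair at distance `d` is `n + 1`, `n + 1 + d`, and count those with no
prime in between by inclusion-exclusion over the `j`-element sets `J` of intermediate positions.
Bonferroni's inequality (`abs_card_consecutivePoints_sub_le`) truncates the alternating sum after
finitely many `j`, so Conjecture H is only used for boundedly many tuple sizes. It turns the `j`-th
term into `x / (log x)^(j+2)` times the sum of the singular series of `{1, d+1} ∪ J` over `J`. If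
that sum is asymptotic to `𝔖(d) d^j / j!`, then `d ~ λ log x` makes the `j`-th term asymptotic to
`λ^j / j!` times `𝔖(d) x / (log x)^2`, and the alternating sum of these is `e^{-λ}`.

The core is thus the mean value `eventually_abs_sum_tupleSingularSeries_sub_le`, a version of
Gallagher's theorem with two points fixed. The Euler product is cut at a level `y`. For the primes
up to `y`, counting pairs of a residue system and a set `J` (`sum_powersetCard_prod_one_sub`)
reduces the average to the sizes of sieved intervals, which the Chinese remainder theorem gives up
to a bounded error. For the primes beyond `y`, adjoining `J` lowers the product by a factor at least
`1 - C/y`. It can raise it only at exceptional primes, those dividing a difference between an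
element of `J` and another point. The resulting weight is close to `1` on average over `J`, since
the sum of `1/p^2` over `p > y` is small. An AM-GM inequality decouples this weight from the
unbounded factor coming from the small primes. -/

open scoped Topology

namespace PrimeTuples

/-! ### Local factors and convergence of the singular series -/

/-- The factor of the singular series at `p`. -/
noncomputable def localFactor (H : Finset ℤ) (p : ℕ) : ℝ :=
  ((1 - 1 / (p : ℝ)) ^ H.card)⁻¹ * (1 - (residueCount H p : ℝ) / (p : ℝ))

lemma one_add_mul_le_inv_pow {u : ℝ} (h0 : 0 ≤ u) (h1 : u < 1) (j : ℕ) :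
    1 + j * u ≤ ((1 - u) ^ j)⁻¹ := by
  have h : 1 + u ≤ (1 - u)⁻¹ := by
    rw [← one_div, le_div_iff₀ (by linarith)]
    nlinarith
  calc 1 + j * u ≤ (1 + u) ^ j := one_add_mul_le_pow (by linarith) j
    _ ≤ ((1 - u)⁻¹) ^ j := by gcongr
    _ = _ := inv_pow _ _

lemma one_sub_mul_le_pow {u : ℝ} (h1 : u ≤ 1) (j : ℕ) :
    1 - j * u ≤ (1 - u) ^ j := by
  have := one_add_mul_le_pow (a := -u) (by linarith) j
  rw [← sub_eq_add_neg] at this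
  linarith

lemma one_div_prime_pos {p : ℕ} (hp : p.Prime) : 0 < 1 / (p : ℝ) :=
  one_div_pos.2 (by exact_mod_cast hp.pos)

lemma one_div_prime_lt_one {p : ℕ} (hp : p.Prime) : 1 / (p : ℝ) < 1 := by
  rw [div_lt_one (by exact_mod_cast hp.pos)]; exact_mod_cast hp.one_lt

lemma residueCount_le_card (H : Finset ℤ) (p : ℕ) : residueCount H p ≤ H.card :=
  Finset.card_image_le

lemma residueCount_le_self (H : Finset ℤ) {p : ℕ} (hp : p.Prime) : residueCount H p ≤ p := by
  have := Fact.mk hp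
  simpa [residueCount, ZMod.card] using
    Finset.card_le_univ (H.image (fun a : ℤ => (a : ZMod p)))

lemma one_sub_residueCount_div_nonneg (H : Finset ℤ) {p : ℕ} (hp : p.Prime) :
    0 ≤ 1 - (residueCount H p : ℝ) / (p : ℝ) := by
  have : (0 : ℝ) < p := by exact_mod_cast hp.pos
  rw [sub_nonneg, div_le_one this]
  exact_mod_cast residueCount_le_self H hp

lemma localFactor_nonneg (H : Finset ℤ) {p : ℕ} (hp : p.Prime) : 0 ≤ localFactor H p :=
  mul_nonneg (inv_nonneg.2 (pow_nonneg (by linarith [one_div_prime_lt_one hp]) _))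
    (one_sub_residueCount_div_nonneg H hp)

lemma residueCount_eq_card_of_lt {H : Finset ℤ} {p : ℕ}
    (hp : ∀ a ∈ H, ∀ b ∈ H, |b - a| < (p : ℤ)) : residueCount H p = H.card := by
  refine Finset.card_image_of_injOn fun a ha b hb hab => ?_
  have hab : (a : ZMod p) = b := hab
  rw [ZMod.intCast_eq_intCast_iff_dvd_sub] at hab
  have := Int.eq_zero_of_abs_lt_dvd hab (hp a ha b hb)
  omega

lemma eventually_residueCount_eq_card (H : Finset ℤ) :
    ∀ᶠ p : ℕ in atTop, residueCount H p = H.card := by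
  -- Such a `p` exceeds every difference of two elements, so distinct elements stay distinct modulo
  -- `p`.
  filter_upwards [eventually_gt_atTop (2 * ∑ a ∈ H, a.natAbs)] with p hp
  refine residueCount_eq_card_of_lt fun a ha b hb => ?_
  have h1 := Finset.single_le_sum (f := fun a : ℤ => a.natAbs) (fun _ _ => Nat.zero_le _) ha
  have h2 := Finset.single_le_sum (f := fun a : ℤ => a.natAbs) (fun _ _ => Nat.zero_le _) hb
  beta_reduce at h1 h2
  rw [abs_lt]
  omega

/-- Bernoulli's inequality used twice: `1 - ku ≤ (1 - u)^k` bounds the product above by `1`, and `(1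
+ ku)(1 - ku) = 1 - (ku)^2` bounds it below. The quadratic error makes the Euler product converge
absolutely. -/
lemma abs_inv_pow_mul_sub_one_le {u : ℝ} (h0 : 0 ≤ u) (h1 : u < 1) (k : ℕ) (hk : k * u ≤ 1) :
    |((1 - u) ^ k)⁻¹ * (1 - k * u) - 1| ≤ k ^ 2 * u ^ 2 := by
  have hpos : 0 < (1 - u) ^ k := pow_pos (by linarith) k
  have hup : ((1 - u) ^ k)⁻¹ * (1 - k * u) ≤ 1 := by
    rw [inv_mul_le_iff₀ hpos, mul_one]
    exact one_sub_mul_le_pow h1.le k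
  have hlo := mul_le_mul_of_nonneg_right (one_add_mul_le_inv_pow h0 h1 k)
    (show 0 ≤ 1 - k * u by linarith)
  rw [abs_le]
  constructor <;> nlinarith [sq_nonneg (k * u)]

lemma summable_localFactor_sub_one (H : Finset ℤ) :
    Summable fun p : ℕ => ‖Set.indicator {p | p.Prime} (fun p => localFactor H p - 1) p‖ := by
  have hs : Summable fun p : ℕ => (H.card : ℝ) ^ 2 * (1 / (p : ℝ) ^ 2) :=
    (Real.summable_one_div_nat_pow.2 one_lt_two).mul_left _
  refine Summable.of_norm_bounded_eventually_nat hs ?_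
  filter_upwards [eventually_residueCount_eq_card H, eventually_ge_atTop H.card] with p hp hk
  rw [norm_norm]
  by_cases hpp : p.Prime
  · have hp0 : (0 : ℝ) < p := by exact_mod_cast hpp.pos
    rw [Set.indicator_of_mem (show p ∈ {p : ℕ | p.Prime} from hpp), Real.norm_eq_abs]
    have := abs_inv_pow_mul_sub_one_le (one_div_prime_pos hpp).le
      (one_div_prime_lt_one hpp) H.card (by
        rw [mul_one_div, div_le_one hp0]; exact_mod_cast hk)
    rw [mul_one_div, one_div_pow] at this
    rwa [localFactor, hp]
  · rw [Set.indicator_of_notMem (show p ∉ {p : ℕ | p.Prime} from hpp), norm_zero]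
    positivity

lemma prod_range_mulIndicator_prime (f : ℕ → ℝ) (n : ℕ) :
    ∏ p ∈ Finset.range n, Set.mulIndicator {p : ℕ | p.Prime} f p = ∏ p ∈ n.primesBelow, f p := by
  rw [Nat.primesBelow, Finset.prod_filter]
  refine Finset.prod_congr rfl fun p _ => ?_
  by_cases hp : p.Prime <;> simp [hp]

/-- Absolute convergence lets the unconditional product be computed as a limit over `p < n`, the
form in which all later comparisons are made prime by prime. -/
lemma tendsto_prod_localFactor (H : Finset ℤ) :
    Tendsto (fun n : ℕ => ∏ p ∈ n.primesBelow, localFactor H p) atTop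
      (𝓝 (tupleSingularSeries H)) := by
  have hm := (multipliable_one_add_of_summable (summable_localFactor_sub_one H)).hasProd
  have heq : (fun p : ℕ => 1 + Set.indicator {p | p.Prime} (fun p => localFactor H p - 1) p) =
      Set.mulIndicator {p : ℕ | p.Prime} (localFactor H) := by
    ext p
    by_cases hp : p.Prime <;> simp [hp]
  rw [heq] at hm
  have h := hm.tendsto_prod_nat
  simp only [prod_range_mulIndicator_prime] at h
  have h2 : tupleSingularSeries H =
      ∏' p : ℕ, Set.mulIndicator {p : ℕ | p.Prime} (localFactor H) p :=
    tprod_subtype {p : ℕ | p.Prime} (localFactor H)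
  rwa [h2]

lemma tupleSingularSeries_nonneg (H : Finset ℤ) : 0 ≤ tupleSingularSeries H :=
  ge_of_tendsto' (tendsto_prod_localFactor H) fun _ =>
    Finset.prod_nonneg fun _ hp => localFactor_nonneg H (Nat.prime_of_mem_primesBelow hp)

lemma tupleSingularSeries_eq_zero_of_not_admissible {H : Finset ℤ} (hH : ¬ Admissible H) :
    tupleSingularSeries H = 0 := by
  simp only [Admissible, not_forall, not_lt] at hH
  obtain ⟨p, hp, hle⟩ := hH
  have he : residueCount H p = p := le_antisymm (residueCount_le_self H hp) hle
  refine tprod_of_exists_eq_zero ⟨⟨p, hp⟩, ?_⟩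
  have : (p : ℝ) ≠ 0 := by exact_mod_cast hp.ne_zero
  simp [he, this]

/-- Conjecture H says nothing about inadmissible sets. If `H` covers all classes modulo `p`, then
`p` divides some prime `n + a`, so `n + a = p` and `n < p`; moreover `p ≤ H.card`. -/
lemma tupleCount_le_of_not_admissible {H : Finset ℤ} (hH : ¬ Admissible H)
    (hpos : ∀ a ∈ H, 1 ≤ a) (x : ℝ) : tupleCount x H ≤ H.card := by
  simp only [Admissible, not_forall, not_lt] at hH
  obtain ⟨p, hp, hle⟩ := hH
  have := Fact.mk hp
  have huniv : H.image (fun a : ℤ => (a : ZMod p)) = Finset.univ := by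
    refine Finset.eq_univ_of_card _ ?_
    rw [ZMod.card]
    exact le_antisymm (residueCount_le_self H hp) hle
  have hsub : {n : ℕ | 1 ≤ n ∧ (n : ℝ) ≤ x ∧ ∀ a ∈ H, ∃ p : ℕ, p.Prime ∧ (n : ℤ) + a = (p : ℤ)} ⊆
      (Finset.Icc 1 p : Finset ℕ) := by
    rintro n ⟨hn1, -, hn⟩
    have : (-(n : ZMod p)) ∈ H.image (fun a : ℤ => (a : ZMod p)) := huniv ▸ Finset.mem_univ _
    obtain ⟨a, ha, hap⟩ := Finset.mem_image.1 this
    obtain ⟨q, hq, hqe⟩ := hn a ha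
    have h0 : (((n : ℤ) + a : ℤ) : ZMod p) = 0 := by push_cast; rw [hap]; ring
    rw [hqe, Int.cast_natCast, ZMod.natCast_eq_zero_iff] at h0
    have hpq := (Nat.prime_dvd_prime_iff_eq hp hq).1 h0
    have := hpos a ha
    simp only [Finset.coe_Icc, Set.mem_Icc]
    omega
  calc tupleCount x H ≤ ((Finset.Icc 1 p : Finset ℕ) : Set ℕ).ncard :=
        Set.ncard_le_ncard hsub (Finset.finite_toSet _)
    _ = p := by rw [Set.ncard_coe_finset]; simp
    _ ≤ residueCount H p := hle
    _ ≤ H.card := residueCount_le_card H p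

/-! ### The singular series of a pair -/

/-- The pair `{1, d + 1}`. -/
def pairSet (d : ℕ) : Finset ℤ := {1, (d : ℤ) + 1}

lemma mem_pairSet {d : ℕ} {a : ℤ} : a ∈ pairSet d ↔ a = 1 ∨ a = d + 1 := by
  simp [pairSet]

lemma card_pairSet {d : ℕ} (hd : 0 < d) : (pairSet d).card = 2 :=
  Finset.card_pair (by omega)

lemma residueCount_pairSet_of_dvd {d p : ℕ} (h : p ∣ d) : residueCount (pairSet d) p = 1 := by
  have : ((d : ℕ) : ZMod p) = 0 := (ZMod.natCast_eq_zero_iff _ _).2 h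
  simp [residueCount, pairSet, this]

lemma residueCount_pairSet_of_not_dvd {d p : ℕ} (h : ¬ p ∣ d) :
    residueCount (pairSet d) p = 2 := by
  have : ((d : ℕ) : ZMod p) ≠ 0 := fun h0 => h ((ZMod.natCast_eq_zero_iff _ _).1 h0)
  simp [residueCount, pairSet, Finset.image_insert, this]

/-- The factors lie in `[0, 1]`, so the product only decreases when the primes are replaced by all
integers; it then telescopes. The index is `i = p - 3`. -/
lemma prod_twinPrime_ge (n : ℕ) :
    (1 / 2 : ℝ) ≤ ∏ p ∈ n.primesBelow with 2 < p, (1 - 1 / ((p : ℝ) - 1) ^ 2) := by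
  have key : ∀ m : ℕ, ∏ i ∈ Finset.range m, (1 - 1 / ((i : ℝ) + 2) ^ 2) =
      ((m : ℝ) + 2) / (2 * (m + 1)) := by
    intro m
    induction m with
    | zero => simp
    | succ m ih =>
      rw [Finset.prod_range_succ, ih]
      push_cast
      field_simp
      ring
  have hfac : ∀ i : ℕ, (0 : ℝ) ≤ 1 - 1 / ((i : ℝ) + 2) ^ 2 ∧
      1 - 1 / ((i : ℝ) + 2) ^ 2 ≤ 1 := by
    intro i
    have : (1 : ℝ) / ((i : ℝ) + 2) ^ 2 ≤ 1 := by
      rw [div_le_one (by positivity)]; nlinarith [Nat.cast_nonneg (α := ℝ) i]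
    constructor
    · linarith
    · have : (0 : ℝ) ≤ 1 / ((i : ℝ) + 2) ^ 2 := by positivity
      linarith
  have himg : ∏ p ∈ n.primesBelow with 2 < p, (1 - 1 / ((p : ℝ) - 1) ^ 2) =
      ∏ i ∈ ((n.primesBelow.filter (2 < ·)).image (fun p : ℕ => p - 3)),
        (1 - 1 / ((i : ℝ) + 2) ^ 2) := by
    rw [Finset.prod_image]
    · refine Finset.prod_congr rfl fun p hp => ?_
      have h2 : 3 ≤ p := (Finset.mem_filter.1 hp).2
      push_cast [h2]
      ring_nf
    · intro a ha b hb hab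
      have h2 : 2 < a := (Finset.mem_filter.1 ha).2
      have h3 : 2 < b := (Finset.mem_filter.1 hb).2
      beta_reduce at hab
      omega
  rw [himg]
  have hsub : (n.primesBelow.filter (2 < ·)).image (fun p : ℕ => p - 3) ⊆ Finset.range n := by
    intro i hi
    obtain ⟨p, hp, rfl⟩ := Finset.mem_image.1 hi
    have := Nat.lt_of_mem_primesBelow (Finset.mem_filter.1 hp).1
    simp only [Finset.mem_range]; omega
  calc (1 / 2 : ℝ) ≤ ((n : ℝ) + 2) / (2 * (n + 1)) := by
        rw [div_le_div_iff₀ (by norm_num) (by positivity)]; linarith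
    _ = _ := (key n).symm
    _ ≤ _ := by
      rw [← Finset.prod_sdiff hsub]
      exact mul_le_of_le_one_left (Finset.prod_nonneg fun i _ => (hfac i).1)
        (Finset.prod_le_one (fun i _ => (hfac i).1) fun i _ => (hfac i).2)

lemma localFactor_pairSet {d : ℕ} (hd : 0 < d) {p : ℕ} (h2 : 2 < p) :
    localFactor (pairSet d) p =
      (1 - 1 / ((p : ℝ) - 1) ^ 2) * if p ∣ d then ((p : ℝ) - 1) / ((p : ℝ) - 2) else 1 := by
  have h2' : (2 : ℝ) < p := by exact_mod_cast h2
  have e1 : (p : ℝ) ≠ 0 := by linarith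
  have e2 : (p : ℝ) - 1 ≠ 0 := by linarith
  have e3 : (p : ℝ) - 2 ≠ 0 := by linarith
  have e4 : 1 - 1 / (p : ℝ) = (p - 1) / p := by field_simp
  rw [localFactor, card_pairSet hd, e4]
  split_ifs with h
  · rw [residueCount_pairSet_of_dvd h]
    field_simp
    push_cast
    ring
  · rw [residueCount_pairSet_of_not_dvd h]
    field_simp
    push_cast
    ring

lemma localFactor_pairSet_two {d : ℕ} (hd : 0 < d) (he : Even d) :
    localFactor (pairSet d) 2 = 2 := by
  rw [localFactor, card_pairSet hd, residueCount_pairSet_of_dvd he.two_dvd]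
  norm_num

lemma tendsto_prod_twinPrime :
    Tendsto (fun n : ℕ => ∏ p ∈ n.primesBelow with 2 < p, (1 - 1 / ((p : ℝ) - 1) ^ 2)) atTop
      (𝓝 twinPrimeConstant) := by
  set f : ℕ → ℝ := fun p => 1 - 1 / ((p : ℝ) - 1) ^ 2
  have hs : Summable fun p : ℕ =>
      ‖Set.indicator {p : ℕ | p.Prime ∧ 2 < p} (fun p => f p - 1) p‖ := by
    -- The constant `4` comes from `p ≤ 2(p - 1)`.
    have hs : Summable fun p : ℕ => 4 * (1 / (p : ℝ) ^ 2) :=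
      (Real.summable_one_div_nat_pow.2 one_lt_two).mul_left _
    refine Summable.of_nonneg_of_le (fun _ => norm_nonneg _) (fun p => ?_) hs
    by_cases hp : p.Prime ∧ 2 < p
    · rw [Set.indicator_of_mem (show p ∈ {p : ℕ | p.Prime ∧ 2 < p} from hp)]
      have : (2 : ℝ) < p := by exact_mod_cast hp.2
      have h1 : f p - 1 = -(1 / ((p : ℝ) - 1) ^ 2) := by simp [f]
      rw [h1, norm_neg, Real.norm_eq_abs, abs_of_nonneg (by positivity), mul_one_div,
        div_le_div_iff₀ (by nlinarith) (by positivity)]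
      nlinarith
    · rw [Set.indicator_of_notMem (show p ∉ {p : ℕ | p.Prime ∧ 2 < p} from hp), norm_zero]
      positivity
  have hm := (multipliable_one_add_of_summable hs).hasProd
  have heq : (fun p : ℕ => 1 + Set.indicator {p : ℕ | p.Prime ∧ 2 < p} (fun p => f p - 1) p) =
      Set.mulIndicator {p : ℕ | p.Prime ∧ 2 < p} f := by
    ext p
    by_cases hp : p.Prime ∧ 2 < p
    · rw [Set.indicator_of_mem (show p ∈ {p : ℕ | p.Prime ∧ 2 < p} from hp),
        Set.mulIndicator_of_mem (show p ∈ {p : ℕ | p.Prime ∧ 2 < p} from hp)]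
      ring
    · rw [Set.indicator_of_notMem (show p ∉ {p : ℕ | p.Prime ∧ 2 < p} from hp),
        Set.mulIndicator_of_notMem (show p ∉ {p : ℕ | p.Prime ∧ 2 < p} from hp), add_zero]
  rw [heq] at hm
  have h := hm.tendsto_prod_nat
  have h2 : twinPrimeConstant = ∏' p : ℕ, Set.mulIndicator {p : ℕ | p.Prime ∧ 2 < p} f p :=
    tprod_subtype {p : ℕ | p.Prime ∧ 2 < p} f
  rw [h2]
  refine h.congr fun n => ?_
  rw [Nat.primesBelow, Finset.filter_filter, Finset.prod_filter]
  refine Finset.prod_congr rfl fun p _ => ?_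
  simp only [Set.mulIndicator, Set.mem_ofPred_eq, f]

lemma twinPrimeConstant_ge : 1 / 2 ≤ twinPrimeConstant :=
  ge_of_tendsto' tendsto_prod_twinPrime prod_twinPrime_ge

lemma pairSingularSeries_eq {d : ℕ} (hd : 0 < d) (he : Even d) :
    pairSingularSeries d = tupleSingularSeries (pairSet d) := by
  refine tendsto_nhds_unique ?_ (tendsto_prod_localFactor (pairSet d))
  rw [pairSingularSeries, if_pos he]
  refine ((tendsto_prod_twinPrime.const_mul 2).mul_const _).congr' ?_
  -- From here on `n` exceeds `2` and every prime divisor of `d`, so the two partial products agree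
  -- exactly.
  filter_upwards [eventually_gt_atTop (d + 2)] with n hn
  have hsplit : n.primesBelow = insert 2 (n.primesBelow.filter (2 < ·)) := by
    ext p
    simp only [Finset.mem_insert, Finset.mem_filter, Nat.mem_primesBelow]
    constructor
    · rintro ⟨h1, h2⟩
      have := h2.two_le
      by_cases h : p = 2
      · exact Or.inl h
      · exact Or.inr ⟨⟨h1, h2⟩, by omega⟩
    · rintro (rfl | h)
      · exact ⟨by omega, Nat.prime_two⟩
      · exact h.1
  conv_rhs => rw [hsplit]
  rw [Finset.prod_insert (by simp), localFactor_pairSet_two hd he, mul_assoc]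
  congr 1
  have hD : d.primeFactors.filter (2 < ·) = (n.primesBelow.filter (2 < ·)).filter (· ∣ d) := by
    ext p
    simp only [Finset.mem_filter, Nat.mem_primeFactors, Nat.mem_primesBelow]
    constructor
    · rintro ⟨⟨h1, h2, h3⟩, h4⟩
      have := Nat.le_of_dvd hd h2
      exact ⟨⟨⟨by omega, h1⟩, h4⟩, h2⟩
    · rintro ⟨⟨⟨h1, h2⟩, h3⟩, h4⟩
      exact ⟨⟨h2, h4, by omega⟩, h3⟩
  rw [hD, Finset.prod_filter _ (fun p : ℕ => ((p : ℝ) - 1) / ((p : ℝ) - 2)),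
    ← Finset.prod_mul_distrib]
  refine Finset.prod_congr rfl fun p hp => ?_
  rw [Finset.mem_filter, Nat.mem_primesBelow] at hp
  rw [localFactor_pairSet hd hp.2]

/-- Uniformity in `d`: the main term is never smaller than `x / (log x)^2`, so powers of `log x` are
negligible against it. -/
lemma one_le_pairSingularSeries {d : ℕ} (he : Even d) : 1 ≤ pairSingularSeries d := by
  rw [pairSingularSeries, if_pos he]
  have h1 : (1 : ℝ) ≤ ∏ p ∈ d.primeFactors with 2 < p, ((p : ℝ) - 1) / ((p : ℝ) - 2) := by
    refine Finset.one_le_prod fun p hp => ?_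
    have : (2 : ℝ) < p := by exact_mod_cast (Finset.mem_filter.1 hp).2
    rw [one_le_div (by linarith)]
    linarith
  nlinarith [twinPrimeConstant_ge]

/-! ### Weights over prime divisors and their mean -/

/-- The weight `(1 - 1 / p)⁻ᵏ`. -/
noncomputable def eulerPow (k p : ℕ) : ℝ := ((1 - 1 / (p : ℝ)) ^ k)⁻¹

lemma one_le_eulerPow (k : ℕ) {p : ℕ} (hp : p.Prime) : 1 ≤ eulerPow k p := by
  have h := one_div_prime_pos hp
  refine le_trans ?_ (one_add_mul_le_inv_pow h.le (one_div_prime_lt_one hp) k)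
  have : 0 ≤ (k : ℝ) * (1 / p) := by positivity
  linarith

lemma eulerPow_pow (k l p : ℕ) : eulerPow k p ^ l = eulerPow (k * l) p := by
  rw [eulerPow, eulerPow, inv_pow, ← pow_mul]

lemma one_add_pow_le_of_le_one {v : ℝ} (h0 : 0 ≤ v) (h1 : v ≤ 1) (k : ℕ) :
    (1 + v) ^ k ≤ 1 + (2 ^ k - 1) * v := by
  induction k with
  | zero => simp
  | succ k ih =>
    have h2 : (1 : ℝ) ≤ 2 ^ k := one_le_pow₀ (by norm_num)
    have := mul_le_mul_of_nonneg_right ih (show 0 ≤ 1 + v by linarith)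
    rw [pow_succ, pow_succ]
    nlinarith [mul_nonneg (mul_nonneg (sub_nonneg.2 h2) h0) (sub_nonneg.2 h1)]

lemma eulerPow_sub_one_le (k : ℕ) {p : ℕ} (hp : p.Prime) :
    eulerPow k p - 1 ≤ 2 * 2 ^ k / p := by
  have h0 := one_div_prime_pos hp
  have h2 : (2 : ℝ) ≤ p := by exact_mod_cast hp.two_le
  have h3 : 1 / (p : ℝ) ≤ 1 / 2 := one_div_le_one_div_of_le (by norm_num) h2
  set u := 1 / (p : ℝ) with hu
  have h4 : (1 - u)⁻¹ ≤ 1 + 2 * u := by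
    rw [inv_le_iff_one_le_mul₀ (by linarith)]
    nlinarith
  have h5 : eulerPow k p ≤ (1 + 2 * u) ^ k := by
    rw [eulerPow, ← inv_pow]
    exact pow_le_pow_left₀ (inv_nonneg.2 (by linarith)) h4 k
  have h6 := one_add_pow_le_of_le_one (v := 2 * u) (by linarith) (by linarith) k
  have h7 : 2 * 2 ^ k / (p : ℝ) = 2 * 2 ^ k * u := by rw [hu, mul_one_div]
  rw [h7]
  nlinarith

lemma card_filter_forall_dvd_le {Q : Finset ℕ} (hQ : ∀ p ∈ Q, p.Prime) (N : ℕ) :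
    (((Finset.Ioc 0 N).filter fun n => ∀ p ∈ Q, p ∣ n).card : ℝ) ≤ N * ∏ p ∈ Q, 1 / (p : ℝ) := by
  have h : ((Finset.Ioc 0 N).filter fun n => ∀ p ∈ Q, p ∣ n) ⊆
      (Finset.Ioc 0 N).filter fun n => (∏ p ∈ Q, p) ∣ n := by
    intro n hn
    rw [Finset.mem_filter] at hn ⊢
    exact ⟨hn.1, Finset.prod_primes_dvd _ (fun p hp => (hQ p hp).prime) hn.2⟩
  calc (((Finset.Ioc 0 N).filter fun n => ∀ p ∈ Q, p ∣ n).card : ℝ)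
      ≤ (((Finset.Ioc 0 N).filter fun n => (∏ p ∈ Q, p) ∣ n).card : ℝ) := by
        exact_mod_cast Finset.card_le_card h
    _ = ((N / ∏ p ∈ Q, p : ℕ) : ℝ) := by rw [Nat.Ioc_filter_dvd_card_eq_div]
    _ ≤ (N : ℝ) / ((∏ p ∈ Q, p : ℕ) : ℝ) := Nat.cast_div_le
    _ = _ := by
      rw [Nat.cast_prod, div_eq_mul_inv, ← Finset.prod_inv_distrib]
      simp only [one_div]

/-- Expand the product over subsets `Q` of `P`. The term of `Q` sees only the multiples of all its
primes, at most `N / ∏ p` in number, and the bound factors back into a product. -/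
lemma sum_prod_one_add_le {P : Finset ℕ} (hP : ∀ p ∈ P, p.Prime) {b : ℕ → ℝ}
    (hb : ∀ p ∈ P, 0 ≤ b p) (N : ℕ) :
    ∑ n ∈ Finset.Ioc 0 N, ∏ p ∈ P, (1 + if p ∣ n then b p else 0) ≤
      N * ∏ p ∈ P, (1 + b p / p) := by
  simp only [Finset.prod_one_add]
  rw [Finset.sum_comm, Finset.mul_sum]
  refine Finset.sum_le_sum fun Q hQ => ?_
  rw [Finset.mem_powerset] at hQ
  simp only [Finset.prod_ite_zero]
  rw [← Finset.sum_filter, Finset.sum_const, nsmul_eq_mul]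
  calc _ ≤ (N * ∏ p ∈ Q, 1 / (p : ℝ)) * ∏ p ∈ Q, b p :=
        mul_le_mul_of_nonneg_right (card_filter_forall_dvd_le (fun p hp => hP p (hQ hp)) N)
          (Finset.prod_nonneg fun p hp => hb p (hQ hp))
    _ = _ := by
      rw [mul_assoc, ← Finset.prod_mul_distrib]
      congr 1
      refine Finset.prod_congr rfl fun p _ => ?_
      ring

/-- The primes `p` with `y < p ≤ N`. -/
def primesBetween (y N : ℕ) : Finset ℕ := (Finset.Ioc y N).filter Nat.Prime

lemma mem_primesBetween {y N p : ℕ} : p ∈ primesBetween y N ↔ (y < p ∧ p ≤ N) ∧ p.Prime := by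
  simp [primesBetween]

/-- The product of `(1 - 1 / p)⁻ᵏ` over the prime divisors `p` of `n` with `y < p ≤ N`. -/
noncomputable def divisorWeight (k y N n : ℕ) : ℝ :=
  ∏ p ∈ primesBetween y N, if p ∣ n then eulerPow k p else 1

lemma one_le_divisorWeight (k y N n : ℕ) : 1 ≤ divisorWeight k y N n := by
  refine Finset.one_le_prod fun p hp => ?_
  split_ifs
  · exact one_le_eulerPow k (mem_primesBetween.1 hp).2
  · exact le_rfl

/-- Moments of the weight are means of weights with a larger exponent, so a bound for the mean
suffices throughout. -/
lemma divisorWeight_pow (k l y N n : ℕ) :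
    divisorWeight k y N n ^ l = divisorWeight (k * l) y N n := by
  rw [divisorWeight, divisorWeight, ← Finset.prod_pow]
  refine Finset.prod_congr rfl fun p _ => ?_
  split_ifs
  · exact eulerPow_pow k l p
  · exact one_pow l

/-- An upper bound for the mean of `divisorWeight k y N - 1`. -/
noncomputable def divisorExcess (k y : ℕ) : ℝ := Real.exp (2 * 2 ^ k / y) - 1

lemma divisorExcess_nonneg (k y : ℕ) : 0 ≤ divisorExcess k y :=
  sub_nonneg.2 (Real.one_le_exp (by positivity))

lemma tendsto_divisorExcess (k : ℕ) : Tendsto (divisorExcess k) atTop (𝓝 0) := by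
  have h : Tendsto (fun y : ℕ => (2 * 2 ^ k : ℝ) / y) atTop (𝓝 0) :=
    tendsto_const_div_atTop_nhds_zero_nat _
  have h2 := ((Real.continuous_exp.tendsto 0).comp h).sub_const 1
  change Tendsto (fun y : ℕ => Real.exp (2 * 2 ^ k / y) - 1) atTop (𝓝 0)
  simpa [Function.comp_def] using h2

lemma sum_inv_sq_primesBetween_le {y : ℕ} (hy : 0 < y) (N : ℕ) :
    ∑ p ∈ primesBetween y N, ((p : ℝ) ^ 2)⁻¹ ≤ 1 / y := by
  rcases le_or_gt y N with h | h
  · calc ∑ p ∈ primesBetween y N, ((p : ℝ) ^ 2)⁻¹ ≤ ∑ p ∈ Finset.Ioc y N, ((p : ℝ) ^ 2)⁻¹ :=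
          Finset.sum_le_sum_of_subset_of_nonneg (Finset.filter_subset _ _)
            fun _ _ _ => by positivity
      _ ≤ (y : ℝ)⁻¹ - (N : ℝ)⁻¹ := sum_Ioc_inv_sq_le_sub hy.ne' h
      _ ≤ 1 / y := by
        rw [one_div]
        have : (0 : ℝ) ≤ (N : ℝ)⁻¹ := by positivity
        linarith
  · rw [primesBetween, Finset.Ioc_eq_empty (by omega)]
    simp

/-- Since `eulerPow k p - 1` is `O(1/p)` and a proportion of at most `1/p` of the integers is
divisible by `p`, each prime costs `O(1/p^2)`; these sum to `O(1/y)`. -/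
lemma sum_divisorWeight_sub_one_le (k : ℕ) {y : ℕ} (hy : 0 < y) (N : ℕ) :
    ∑ n ∈ Finset.Ioc 0 N, (divisorWeight k y N n - 1) ≤ N * divisorExcess k y := by
  have h1 : ∀ n, divisorWeight k y N n =
      ∏ p ∈ primesBetween y N, (1 + if p ∣ n then eulerPow k p - 1 else 0) := by
    intro n
    refine Finset.prod_congr rfl fun p _ => ?_
    split_ifs <;> ring
  have hprime : ∀ p ∈ primesBetween y N, p.Prime := fun p hp => (mem_primesBetween.1 hp).2
  have h2 := sum_prod_one_add_le hprime (b := fun p => eulerPow k p - 1)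
    (fun p hp => sub_nonneg.2 (one_le_eulerPow k (hprime p hp))) N
  have h3 : ∏ p ∈ primesBetween y N, (1 + (eulerPow k p - 1) / p) ≤
      Real.exp (2 * 2 ^ k / y) := by
    refine (Finset.prod_le_prod (fun p hp => ?_) fun p _ =>
      (add_comm _ _).trans_le (Real.add_one_le_exp ((eulerPow k p - 1) / p))).trans ?_
    · exact add_nonneg zero_le_one
        (div_nonneg (sub_nonneg.2 (one_le_eulerPow k (hprime p hp))) (Nat.cast_nonneg _))
    rw [← Real.exp_sum]
    refine Real.exp_le_exp.2 ?_
    calc ∑ p ∈ primesBetween y N, (eulerPow k p - 1) / p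
          ≤ ∑ p ∈ primesBetween y N, 2 * 2 ^ k * ((p : ℝ) ^ 2)⁻¹ := by
            refine Finset.sum_le_sum fun p hp => ?_
            have hp0 : (0 : ℝ) < p := by exact_mod_cast (hprime p hp).pos
            calc (eulerPow k p - 1) / p ≤ (2 * 2 ^ k / p) / p :=
                  div_le_div_of_nonneg_right (eulerPow_sub_one_le k (hprime p hp)) hp0.le
              _ = _ := by field_simp
        _ ≤ 2 * 2 ^ k * (1 / y) := by
            rw [← Finset.mul_sum]
            exact mul_le_mul_of_nonneg_left (sum_inv_sq_primesBetween_le hy N) (by positivity)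
        _ = _ := by ring
  rw [Finset.sum_sub_distrib]
  simp only [h1, Finset.sum_const, Nat.card_Ioc, nsmul_eq_mul, divisorExcess]
  have h4 := mul_le_mul_of_nonneg_left h3 (Nat.cast_nonneg (α := ℝ) N)
  simp only [tsub_zero]
  linarith

/-! ### Averages over subsets of fixed size -/

section SubsetSums

variable {α : Type*}

/-- Bound all factors by the largest, `x m`: the product is at most `x m ^ L`, and the sum contains
the term of `m`. -/
lemma prod_sub_one_le_sum_pow_sub_one (S : Finset α) {x : α → ℝ} (hx : ∀ l, 1 ≤ x l) {L : ℕ}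
    (hL : S.card ≤ L) : ∏ l ∈ S, x l - 1 ≤ ∑ l ∈ S, (x l ^ L - 1) := by
  rcases S.eq_empty_or_nonempty with rfl | hS
  · simp
  · obtain ⟨m, hm, hmax⟩ := S.exists_max_image x hS
    calc ∏ l ∈ S, x l - 1 ≤ ∏ _l ∈ S, x m - 1 :=
          sub_le_sub_right
            (Finset.prod_le_prod (fun l _ => zero_le_one.trans (hx l)) fun l hl => hmax l hl) 1
      _ ≤ x m ^ L - 1 := by
          rw [Finset.prod_const]
          exact sub_le_sub_right (pow_le_pow_right₀ (hx m) hL) 1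
      _ ≤ _ := Finset.single_le_sum (f := fun l => x l ^ L - 1)
          (fun l _ => sub_nonneg.2 (one_le_pow₀ (hx l))) hm

variable [DecidableEq α]

/-- A set `J ⊇ s` is determined by `J \ s`, for which there are at most `I.card ^ (j - s.card)`
choices. The multiplied form also covers `j < s.card`. -/
lemma card_filter_subset_powersetCard_mul_le (I s : Finset α) (j : ℕ) :
    ((I.powersetCard j).filter (s ⊆ ·)).card * I.card ^ s.card ≤ I.card ^ j := by
  rcases lt_or_ge j s.card with h | h
  · have : (I.powersetCard j).filter (s ⊆ ·) = ∅ := by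
      refine Finset.filter_false_of_mem fun J hJ hs => ?_
      have := Finset.card_le_card hs
      rw [(Finset.mem_powersetCard.1 hJ).2] at this
      omega
    simp [this]
  · have h1 : ((I.powersetCard j).filter (s ⊆ ·)).card ≤ (I.powersetCard (j - s.card)).card := by
      refine Finset.card_le_card_of_injOn (fun J => J \ s) ?_ ?_
      · intro J hJ
        rw [Finset.mem_coe, Finset.mem_filter, Finset.mem_powersetCard] at hJ
        rw [Finset.mem_coe, Finset.mem_powersetCard, Finset.card_sdiff_of_subset hJ.2, hJ.1.2]
        exact ⟨Finset.sdiff_subset.trans hJ.1.1, rfl⟩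
      · intro J hJ J' hJ' he
        rw [Finset.mem_coe, Finset.mem_filter] at hJ hJ'
        beta_reduce at he
        rw [← Finset.sdiff_union_of_subset hJ.2, he, Finset.sdiff_union_of_subset hJ'.2]
    rw [Finset.card_powersetCard] at h1
    calc _ ≤ I.card ^ (j - s.card) * I.card ^ s.card :=
          Nat.mul_le_mul_right _ (h1.trans (Nat.choose_le_pow _ _))
      _ = _ := by rw [← pow_add, Nat.sub_add_cancel h]

lemma card_mul_sum_powersetCard_sum_le (I : Finset α) (j : ℕ) {f : α → ℝ} (hf : ∀ a, 0 ≤ f a) :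
    I.card * ∑ J ∈ I.powersetCard j, ∑ a ∈ J, f a ≤ I.card ^ j * ∑ a ∈ I, f a := by
  have h : ∑ J ∈ I.powersetCard j, ∑ a ∈ J, f a =
      ∑ a ∈ I, (((I.powersetCard j).filter ({a} ⊆ ·)).card : ℝ) * f a := by
    rw [Finset.sum_comm' (t' := I) (s' := fun a => (I.powersetCard j).filter ({a} ⊆ ·))]
    · simp
    · intro J a
      simp only [Finset.mem_filter, Finset.singleton_subset_iff, Finset.mem_powersetCard]
      constructor
      · rintro ⟨⟨h1, h2⟩, h3⟩; exact ⟨⟨⟨h1, h2⟩, h3⟩, h1 h3⟩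
      · rintro ⟨⟨⟨h1, h2⟩, h3⟩, -⟩; exact ⟨⟨h1, h2⟩, h3⟩
  rw [h, Finset.mul_sum, Finset.mul_sum]
  refine Finset.sum_le_sum fun a _ => ?_
  have := card_filter_subset_powersetCard_mul_le I {a} j
  rw [Finset.card_singleton, pow_one] at this
  have h' : (((I.powersetCard j).filter ({a} ⊆ ·)).card : ℝ) * I.card ≤ I.card ^ j := by
    exact_mod_cast this
  nlinarith [mul_le_mul_of_nonneg_right h' (hf a)]

lemma card_sq_mul_sum_powersetCard_sum_le (I : Finset α) (j : ℕ) {g : α → α → ℝ}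
    (hg : ∀ a b, 0 ≤ g a b) :
    I.card ^ 2 * ∑ J ∈ I.powersetCard j, ∑ b ∈ J, ∑ a ∈ J.erase b, g a b ≤
      I.card ^ j * ∑ b ∈ I, ∑ a ∈ I.erase b, g a b := by
  have h : ∑ J ∈ I.powersetCard j, ∑ b ∈ J, ∑ a ∈ J.erase b, g a b =
      ∑ b ∈ I, ∑ a ∈ I.erase b,
        (((I.powersetCard j).filter ({a, b} ⊆ ·)).card : ℝ) * g a b := by
    have h1 : ∀ J : Finset α, ∑ b ∈ J, ∑ a ∈ J.erase b, g a b =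
        ∑ x ∈ J.sigma (fun b => J.erase b), g x.2 x.1 := fun J => by rw [Finset.sum_sigma]
    simp only [h1]
    rw [Finset.sum_comm' (t' := I.sigma (fun b => I.erase b))
      (s' := fun x => (I.powersetCard j).filter ({x.2, x.1} ⊆ ·)), Finset.sum_sigma]
    · simp
    · rintro J ⟨b, a⟩
      simp only [Finset.mem_filter, Finset.insert_subset_iff, Finset.singleton_subset_iff,
        Finset.mem_powersetCard, Finset.mem_sigma, Finset.mem_erase]
      constructor
      · rintro ⟨⟨h1, h2⟩, h3, h4, h5⟩
        exact ⟨⟨⟨h1, h2⟩, h5, h3⟩, h1 h3, h4, h1 h5⟩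
      · rintro ⟨⟨⟨h1, h2⟩, h5, h3⟩, -, h4, -⟩
        exact ⟨⟨h1, h2⟩, h3, h4, h5⟩
  rw [h, Finset.mul_sum, Finset.mul_sum]
  refine Finset.sum_le_sum fun b _ => ?_
  rw [Finset.mul_sum, Finset.mul_sum]
  refine Finset.sum_le_sum fun a ha => ?_
  have := card_filter_subset_powersetCard_mul_le I {a, b} j
  rw [Finset.card_pair (Finset.ne_of_mem_erase ha)] at this
  have h' : (((I.powersetCard j).filter ({a, b} ⊆ ·)).card : ℝ) * I.card ^ 2 ≤ I.card ^ j := by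
    exact_mod_cast this
  nlinarith [mul_le_mul_of_nonneg_right h' (hg a b)]

end SubsetSums

/-! ### Exceptional primes, on average over `J` -/

/-- The integers strictly between the elements of `pairSet d`. -/
noncomputable def gap (d : ℕ) : Finset ℤ := Finset.Ioo 1 ((d : ℤ) + 1)

lemma mem_gap {d : ℕ} {a : ℤ} : a ∈ gap d ↔ 1 < a ∧ a < d + 1 := Finset.mem_Ioo

lemma card_gap (d : ℕ) : (gap d).card = d - 1 := by
  rw [gap, Int.card_Ioo]; omega

/-- Each distance from `b` lies in `[1, d]` and occurs at most once on either side of `b`. -/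
lemma sum_erase_gap_natAbs_le {d : ℕ} {G : ℕ → ℝ} (hG : ∀ n, 0 ≤ G n) {b : ℤ} (h1 : 1 ≤ b)
    (h2 : b ≤ d + 1) :
    ∑ a ∈ (gap d).erase b, G (a - b).natAbs ≤ 2 * ∑ n ∈ Finset.Ioc 0 d, G n := by
  have key : ∀ s ⊆ (gap d).erase b, Set.InjOn (fun a : ℤ => (a - b).natAbs) s →
      ∑ a ∈ s, G (a - b).natAbs ≤ ∑ n ∈ Finset.Ioc 0 d, G n := by
    intro s hs hinj
    rw [← Finset.sum_image (f := G) hinj]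
    refine Finset.sum_le_sum_of_subset_of_nonneg ?_ fun n _ _ => hG n
    intro n hn
    obtain ⟨a, ha, rfl⟩ := Finset.mem_image.1 hn
    have := hs ha
    rw [Finset.mem_erase, mem_gap] at this
    rw [Finset.mem_Ioc]
    omega
  rw [← Finset.sum_filter_add_sum_filter_not _ (· < b), two_mul]
  refine add_le_add (key _ (Finset.filter_subset _ _) ?_) (key _ (Finset.filter_subset _ _) ?_) <;>
  · intro x hx y hy hxy
    have hx := (Finset.mem_filter.1 hx).2
    have hy := (Finset.mem_filter.1 hy).2
    beta_reduce at hxy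
    omega

/-- A prime `p` is exceptional for `J` if some element of `J` is congruent modulo `p` to another
element of `pairSet d ∪ J`. -/
def Exceptional (d : ℕ) (J : Finset ℤ) (p : ℕ) : Prop :=
  ∃ a ∈ J, ∃ b ∈ (pairSet d ∪ J).erase a, (p : ℤ) ∣ a - b

open Classical in
/-- The product of `(1 - 1 / p)⁻ᵏ` over the exceptional primes `p` with `y < p ≤ d`. -/
noncomputable def exceptionalWeight (k y d : ℕ) (J : Finset ℤ) : ℝ :=
  ∏ p ∈ primesBetween y d, if Exceptional d J p then eulerPow k p else 1

lemma one_le_exceptionalWeight (k y d : ℕ) (J : Finset ℤ) : 1 ≤ exceptionalWeight k y d J := by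
  refine Finset.one_le_prod fun p hp => ?_
  split_ifs
  · exact one_le_eulerPow k (mem_primesBetween.1 hp).2
  · exact le_rfl

lemma exceptionalWeight_pow (k l y d : ℕ) (J : Finset ℤ) :
    exceptionalWeight k y d J ^ l = exceptionalWeight (k * l) y d J := by
  rw [exceptionalWeight, exceptionalWeight, ← Finset.prod_pow]
  refine Finset.prod_congr rfl fun p _ => ?_
  split_ifs
  · exact eulerPow_pow k l p
  · exact one_pow l

/-- An exceptional prime divides some difference `a - b`, so the weight is at most a product of
divisor weights over at most `j(j + 2)` pairs, where `j = J.card`. Passing from this product to a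
sum multiplies `k` by that number. -/
lemma exceptionalWeight_sub_one_le (k y d : ℕ) (J : Finset ℤ) :
    exceptionalWeight k y d J - 1 ≤ ∑ a ∈ J, ∑ b ∈ (pairSet d ∪ J).erase a,
      (divisorWeight (k * (J.card * (J.card + 2))) y d (a - b).natAbs - 1) := by
  classical
  set S := J.sigma fun a => (pairSet d ∪ J).erase a with hS
  have hcard : S.card ≤ J.card * (J.card + 2) := by
    rw [hS, Finset.card_sigma]
    calc ∑ a ∈ J, ((pairSet d ∪ J).erase a).card ≤ ∑ a ∈ J, (J.card + 2) := by
          refine Finset.sum_le_sum fun a _ => ?_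
          refine (Finset.card_erase_le).trans ((Finset.card_union_le _ _).trans ?_)
          have : (pairSet d).card ≤ 2 := Finset.card_le_two
          omega
      _ = _ := by rw [Finset.sum_const, smul_eq_mul]
  have h1 : exceptionalWeight k y d J ≤
      ∏ x ∈ S, divisorWeight k y d (x.1 - x.2).natAbs := by
    simp only [divisorWeight]
    rw [Finset.prod_comm]
    refine Finset.prod_le_prod (fun p hp => ?_) fun p hp => ?_
    · have := one_le_eulerPow k (mem_primesBetween.1 hp).2
      split_ifs <;> linarith
    · have hge : ∀ x : (_ : ℤ) × ℤ,
          1 ≤ if p ∣ (x.1 - x.2).natAbs then eulerPow k p else 1 := by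
        intro x
        split_ifs
        · exact one_le_eulerPow k (mem_primesBetween.1 hp).2
        · exact le_rfl
      split_ifs with hE
      · obtain ⟨a, ha, b, hb, hab⟩ := hE
        have hmem : (⟨a, b⟩ : (_ : ℤ) × ℤ) ∈ S := Finset.mem_sigma.2 ⟨ha, hb⟩
        have hdvd : p ∣ (a - b).natAbs := Int.natCast_dvd.1 hab
        rw [← Finset.mul_prod_erase _ _ hmem, if_pos hdvd]
        exact le_mul_of_one_le_right
          (zero_le_one.trans (one_le_eulerPow k (mem_primesBetween.1 hp).2))
          (Finset.one_le_prod fun x _ => hge x)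
      · exact Finset.one_le_prod fun x _ => hge x
  have h2 := prod_sub_one_le_sum_pow_sub_one S
    (x := fun x => divisorWeight k y d (x.1 - x.2).natAbs)
    (fun x => one_le_divisorWeight _ _ _ _) hcard
  simp only [divisorWeight_pow] at h2
  rw [hS, Finset.sum_sigma] at h2
  exact (sub_le_sub_right h1 1).trans h2

lemma sum_exceptionalWeight_sub_one_le (k j : ℕ) {y d : ℕ} (hy : 0 < y) (hd : 2 ≤ d) :
    ∑ J ∈ (gap d).powersetCard j, (exceptionalWeight k y d J - 1) ≤
      12 * divisorExcess (k * (j * (j + 2))) y * d ^ j := by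
  set G : ℕ → ℝ := fun n => divisorWeight (k * (j * (j + 2))) y d n - 1 with hGdef
  have hG : ∀ n, 0 ≤ G n := fun n => sub_nonneg.2 (one_le_divisorWeight _ _ _ _)
  set A : ℝ := 2 * (d * divisorExcess (k * (j * (j + 2))) y) with hA
  have hA0 : 0 ≤ A :=
    mul_nonneg zero_le_two (mul_nonneg (Nat.cast_nonneg _) (divisorExcess_nonneg _ _))
  have hmean : ∀ b : ℤ, 1 ≤ b → b ≤ d + 1 →
      ∑ a ∈ (gap d).erase b, G (a - b).natAbs ≤ A := fun b h1 h2 =>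
    (sum_erase_gap_natAbs_le hG h1 h2).trans
      (mul_le_mul_of_nonneg_left (sum_divisorWeight_sub_one_le _ hy d) zero_le_two)
  set n : ℝ := ((gap d).card : ℝ) with hn
  have hnd : n = d - 1 := by rw [hn, card_gap]; push_cast [show 1 ≤ d by omega]; ring
  have hd2 : (2 : ℝ) ≤ d := by exact_mod_cast hd
  have hn0 : 0 < n := by rw [hnd]; linarith
  -- Differences with an endpoint need only a single sum over `J`; those within `J`, treated in
  -- `hself`, need a double one.
  have hpair : ∀ b ∈ pairSet d,
      n * ∑ J ∈ (gap d).powersetCard j, ∑ a ∈ J, G (a - b).natAbs ≤ n ^ j * A := by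
    intro b hb
    have hb' := mem_pairSet.1 hb
    have hnot : b ∉ gap d := by rw [mem_gap]; omega
    refine (card_mul_sum_powersetCard_sum_le (gap d) j
      (f := fun a => G (a - b).natAbs) fun a => hG _).trans ?_
    refine mul_le_mul_of_nonneg_left ?_ (by positivity)
    have := hmean b (by omega) (by omega)
    rwa [Finset.erase_eq_of_notMem hnot] at this
  have hself : n * ∑ J ∈ (gap d).powersetCard j, ∑ b ∈ J, ∑ a ∈ J.erase b, G (a - b).natAbs ≤
      n ^ j * A := by
    have h := card_sq_mul_sum_powersetCard_sum_le (gap d) j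
      (g := fun a b => G (a - b).natAbs) fun a b => hG _
    have h2 : ∑ b ∈ gap d, ∑ a ∈ (gap d).erase b, G (a - b).natAbs ≤ n * A := by
      rw [hn, ← nsmul_eq_mul, ← Finset.sum_const]
      refine Finset.sum_le_sum fun b hb => hmean b ?_ ?_ <;> rw [mem_gap] at hb <;> omega
    have h3 := h.trans (mul_le_mul_of_nonneg_left h2 (by positivity))
    refine le_of_mul_le_mul_left ?_ hn0
    calc _ = _ := by ring
      _ ≤ _ := h3
      _ = _ := by ring
  have hJ : ∀ J ∈ (gap d).powersetCard j, exceptionalWeight k y d J - 1 ≤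
      ∑ b ∈ pairSet d, ∑ a ∈ J, G (a - b).natAbs +
        ∑ b ∈ J, ∑ a ∈ J.erase b, G (a - b).natAbs := by
    intro J hJ
    obtain ⟨hJ1, hJ2⟩ := Finset.mem_powersetCard.1 hJ
    have h := exceptionalWeight_sub_one_le k y d J
    rw [hJ2] at h
    refine h.trans ?_
    have hsym : ∑ b ∈ J, ∑ a ∈ J.erase b, G (a - b).natAbs =
        ∑ a ∈ J, ∑ b ∈ J.erase a, G (a - b).natAbs := by
      refine Finset.sum_comm' fun b a => ?_
      simp only [Finset.mem_erase]
      tauto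
    rw [hsym, Finset.sum_comm (s := pairSet d), ← Finset.sum_add_distrib]
    refine Finset.sum_le_sum fun a ha => ?_
    have hnot : a ∉ pairSet d := by
      have := hJ1 ha
      rw [mem_gap] at this
      rw [mem_pairSet]; omega
    have hdisj : Disjoint (pairSet d) (J.erase a) := by
      rw [Finset.disjoint_left]
      intro b hb hb2
      have := hJ1 (Finset.mem_of_mem_erase hb2)
      rw [mem_gap] at this
      rw [mem_pairSet] at hb; omega
    rw [Finset.erase_union_distrib, Finset.erase_eq_of_notMem hnot, Finset.sum_union hdisj]
  have htot : n * ∑ J ∈ (gap d).powersetCard j, (exceptionalWeight k y d J - 1) ≤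
      3 * (n ^ j * A) := by
    have h1 := mul_le_mul_of_nonneg_left (Finset.sum_le_sum hJ) hn0.le
    rw [Finset.sum_add_distrib, mul_add, Finset.sum_comm (t := pairSet d), Finset.mul_sum
      (s := pairSet d)] at h1
    have h2 := Finset.sum_le_sum hpair
    rw [Finset.sum_const, card_pairSet (by omega), nsmul_eq_mul] at h2
    push_cast at h2
    linarith
  have hnj : n ^ j ≤ (d : ℝ) ^ j := pow_le_pow_left₀ hn0.le (by linarith) j
  refine le_of_mul_le_mul_left (htot.trans ?_) hn0
  have he := divisorExcess_nonneg (k * (j * (j + 2))) y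
  have h1 : n ^ j * A ≤ d ^ j * A := mul_le_mul_of_nonneg_right hnj hA0
  -- Here `d ≤ 2(d - 1) = 2n`. With one contribution `A` from each endpoint and one from within `J`,
  -- this gives `12 = 3 · 4`.
  have h2 : A ≤ 4 * n * divisorExcess (k * (j * (j + 2))) y := by
    rw [hA]; nlinarith
  have h3 := mul_le_mul_of_nonneg_left h2 (show (0 : ℝ) ≤ d ^ j by positivity)
  linarith

/-! ### Small primes: residue systems and sieved intervals -/

lemma card_filter_forall_add_ne_zero (H : Finset ℤ) {p : ℕ} [Fact p.Prime] :
    ((Finset.univ.filter fun x : ZMod p => ∀ h ∈ H, x + (h : ZMod p) ≠ 0).card : ℝ) =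
      p * (1 - (residueCount H p : ℝ) / p) := by
  have hp : p.Prime := Fact.out
  have h1 : (Finset.univ.filter fun x : ZMod p => ∀ h ∈ H, x + (h : ZMod p) ≠ 0) =
      ((H.image fun a : ℤ => (a : ZMod p)).image Neg.neg)ᶜ := by
    ext x
    simp only [Finset.mem_filter, Finset.mem_univ, true_and, Finset.mem_compl, Finset.mem_image,
      exists_exists_and_eq_and, not_exists, not_and, ne_eq]
    refine forall₂_congr fun h _ => not_congr ⟨fun e => ?_, fun e => ?_⟩
    · rw [add_comm] at e; exact neg_eq_of_add_eq_zero_right e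
    · rw [← e, neg_add_cancel]
  have hp0 : (p : ℝ) ≠ 0 := by exact_mod_cast hp.ne_zero
  rw [h1, Finset.card_compl, Finset.card_image_of_injective _ neg_injective, ZMod.card]
  change ((p - residueCount H p : ℕ) : ℝ) = _
  rw [Nat.cast_sub (residueCount_le_self H hp)]
  field_simp

/-- The residue systems modulo the elements of `S`. -/
abbrev ResidueSystem (S : Finset ℕ) : Type := (p : S) → ZMod (p : ℕ)

lemma card_residueSystem_filter_forall {S : Finset ℕ} [∀ p : S, Fact (p : ℕ).Prime]
    (H : Finset ℤ) :
    ((Finset.univ.filter fun t : ResidueSystem S =>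
      ∀ p : S, ∀ h ∈ H, t p + (h : ZMod (p : ℕ)) ≠ 0).card : ℝ) =
      (∏ p ∈ S, (p : ℝ)) * ∏ p ∈ S, (1 - (residueCount H p : ℝ) / p) := by
  have h : (Finset.univ.filter fun t : ResidueSystem S =>
      ∀ p : S, ∀ h ∈ H, t p + (h : ZMod (p : ℕ)) ≠ 0) =
      Fintype.piFinset fun p : S =>
        Finset.univ.filter fun x : ZMod (p : ℕ) => ∀ h ∈ H, x + (h : ZMod (p : ℕ)) ≠ 0 := by
    ext t
    simp
  rw [h, Fintype.card_piFinset, Nat.cast_prod, ← Finset.prod_mul_distrib,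
    ← Finset.prod_coe_sort S]
  exact Finset.prod_congr rfl fun p _ => card_filter_forall_add_ne_zero H

lemma abs_card_gap_filter_modEq_sub_le (d : ℕ) (hd : 0 < d) {r : ℤ} (hr : 0 < r) (v : ℤ) :
    |(((gap d).filter fun h => h ≡ v [ZMOD r]).card : ℝ) - ((d : ℝ) - 1) / r| ≤ 1 := by
  have hgap : gap d = Finset.Ioc 1 (d : ℤ) := by
    ext a; rw [mem_gap, Finset.mem_Ioc]; omega
  have h := Int.Ioc_filter_modEq_card 1 (d : ℤ) hr v
  rw [← hgap] at h
  have hrq : (0 : ℚ) < r := by exact_mod_cast hr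
  have hdq : (1 : ℚ) ≤ d := by exact_mod_cast hd
  have key : |(((gap d).filter fun h => h ≡ v [ZMOD r]).card : ℚ) - ((d : ℚ) - 1) / r| ≤ 1 := by
    have hc : (((gap d).filter fun h => h ≡ v [ZMOD r]).card : ℚ) =
        (((((gap d).filter fun h => h ≡ v [ZMOD r]).card : ℤ)) : ℚ) := by push_cast; rfl
    rw [hc, h]
    have h1 := Int.floor_le ((((d : ℤ) : ℚ) - v) / r)
    have h2 := Int.lt_floor_add_one ((((d : ℤ) : ℚ) - v) / r)
    have h3 := Int.floor_le ((((1 : ℤ) : ℚ) - v) / r)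
    have h4 := Int.lt_floor_add_one ((((1 : ℤ) : ℚ) - v) / r)
    have h5 : (((d : ℤ) : ℚ) - v) / r - (((1 : ℤ) : ℚ) - v) / r = ((d : ℚ) - 1) / r := by
      push_cast; ring
    have h6 : 0 ≤ ((d : ℚ) - 1) / r := div_nonneg (by linarith) hrq.le
    rw [Int.cast_max, Int.cast_sub, Int.cast_zero, abs_le]
    constructor
    · have := le_max_left ((⌊(((d : ℤ) : ℚ) - v) / r⌋ : ℚ) - ⌊(((1 : ℤ) : ℚ) - v) / r⌋) 0
      linarith
    · rw [sub_le_iff_le_add]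
      exact max_le (by linarith) (by linarith)
  have := (Rat.cast_le (K := ℝ)).2 key
  push_cast at this
  exact this

/-- By the Chinese remainder theorem the conditions amount to one congruence modulo `∏ p`. -/
lemma abs_card_gap_filter_eq_sub_le {S : Finset ℕ} (hS : ∀ p ∈ S, p.Prime) {d : ℕ} (hd : 0 < d)
    (u : ResidueSystem S) :
    |(((gap d).filter fun h => ∀ p : S, (h : ZMod (p : ℕ)) = u p).card : ℝ) -
      ((d : ℝ) - 1) / ∏ p ∈ S, (p : ℝ)| ≤ 1 := by
  have hcop : Pairwise (Function.onFun Nat.Coprime fun p : S => (p : ℕ)) := fun p q hpq =>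
    (Nat.coprime_primes (hS p p.2) (hS q q.2)).2 fun h => hpq (Subtype.ext h)
  set e := ZMod.prodEquivPi (fun p : S => (p : ℕ)) hcop
  set N := ∏ p : S, (p : ℕ) with hN
  have hN0 : 0 < N := Finset.prod_pos fun p _ => (hS p p.2).pos
  have : NeZero N := ⟨hN0.ne'⟩
  have hcond : ∀ h : ℤ, (∀ p : S, (h : ZMod (p : ℕ)) = u p) ↔
      h ≡ ((e.symm u).val : ℤ) [ZMOD N] := by
    intro h
    rw [← ZMod.intCast_eq_intCast_iff, Int.cast_natCast, ZMod.natCast_zmod_val,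
      RingEquiv.eq_symm_apply, map_intCast, funext_iff]
    rfl
  have hprod : ((N : ℤ) : ℝ) = ∏ p ∈ S, (p : ℝ) := by
    rw [hN, ← Finset.prod_coe_sort S]; push_cast; rfl
  simp only [hcond, ← hprod]
  exact abs_card_gap_filter_modEq_sub_le d hd (by exact_mod_cast hN0) _

open Classical in
/-- The elements `h` of `gap d` such that `t + h` vanishes modulo no element of `S`. -/
noncomputable def sievedGap {S : Finset ℕ} (d : ℕ) (t : ResidueSystem S) : Finset ℤ :=
  (gap d).filter fun h => ∀ p : S, t p + (h : ZMod (p : ℕ)) ≠ 0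

/-- Sort the surviving `h` by the residue system `u` of `t + h`, which has no zero entry. There are
`∏ (p - 1)` such systems, and each contributes `(d - 1) / ∏ p` with error at most `1`. The main term
does not depend on `t`. -/
lemma abs_card_sievedGap_sub_le {S : Finset ℕ} (hS : ∀ p ∈ S, p.Prime) {d : ℕ} (hd : 0 < d)
    (t : ResidueSystem S) :
    |((sievedGap d t).card : ℝ) - (∏ p ∈ S, (1 - 1 / (p : ℝ))) * (d - 1)| ≤
      (∏ p ∈ S, (1 - 1 / (p : ℝ))) * ∏ p ∈ S, (p : ℝ) := by
  classical
  have hF : ∀ p : S, Fact (p : ℕ).Prime := fun p => ⟨hS p p.2⟩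
  set U := Finset.univ.filter fun u : ResidueSystem S => ∀ p : S, u p ≠ 0 with hU
  have hUcard : (U.card : ℝ) = (∏ p ∈ S, (1 - 1 / (p : ℝ))) * ∏ p ∈ S, (p : ℝ) := by
    have h := card_residueSystem_filter_forall (S := S) {0}
    simp only [Finset.mem_singleton, forall_eq, Int.cast_zero, add_zero] at h
    rw [hU, h, mul_comm]
    simp [residueCount]
  have hP : (0 : ℝ) < ∏ p ∈ S, (p : ℝ) :=
    Finset.prod_pos fun p hp => by exact_mod_cast (hS p hp).pos
  have hsum : ((sievedGap d t).card : ℝ) = ∑ u ∈ U,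
      (((gap d).filter fun h => ∀ p : S, (h : ZMod (p : ℕ)) = (u - t) p).card : ℝ) := by
    rw [← Nat.cast_sum]
    congr 1
    rw [Finset.card_eq_sum_card_fiberwise (f := fun (h : ℤ) (p : S) => t p + (h : ZMod (p : ℕ)))
      (t := U)]
    · refine Finset.sum_congr rfl fun u hu => ?_
      congr 1
      ext h
      simp only [sievedGap, Finset.mem_filter, funext_iff, Pi.sub_apply, eq_sub_iff_add_eq']
      constructor
      · rintro ⟨⟨h1, -⟩, h2⟩; exact ⟨h1, h2⟩
      · rintro ⟨h1, h2⟩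
        refine ⟨⟨h1, fun p => ?_⟩, h2⟩
        rw [h2 p]
        exact (Finset.mem_filter.1 hu).2 p
    · intro h hh
      have := (Finset.mem_filter.1 hh).2
      simpa [hU] using this
  have hmain : (∏ p ∈ S, (1 - 1 / (p : ℝ))) * ((d : ℝ) - 1) =
      ∑ _u ∈ U, ((d : ℝ) - 1) / ∏ p ∈ S, (p : ℝ) := by
    rw [Finset.sum_const, nsmul_eq_mul, hUcard]
    field_simp
  rw [hsum, hmain, ← Finset.sum_sub_distrib, ← hUcard]
  refine (Finset.abs_sum_le_sum_abs _ _).trans ?_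
  refine (Finset.sum_le_sum fun u _ => abs_card_gap_filter_eq_sub_le hS hd (u - t)).trans ?_
  simp

/-- Both sides count the pairs `(t, J)` for which `t + h` vanishes modulo no prime of `S` for any
`h` in `pairSet d ∪ J`: on the left `J` is fixed first, on the right `t`. -/
lemma sum_powersetCard_prod_one_sub {S : Finset ℕ} [∀ p : S, Fact (p : ℕ).Prime] (d j : ℕ) :
    (∏ p ∈ S, (p : ℝ)) * ∑ J ∈ (gap d).powersetCard j,
      ∏ p ∈ S, (1 - (residueCount (pairSet d ∪ J) p : ℝ) / p) =
    ∑ t : ResidueSystem S with ∀ p : S, ∀ h ∈ pairSet d, t p + (h : ZMod (p : ℕ)) ≠ 0,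
      ((sievedGap d t).card.choose j : ℝ) := by
  classical
  rw [Finset.mul_sum]
  simp only [← card_residueSystem_filter_forall]
  rw [← Nat.cast_sum, ← Nat.cast_sum]
  congr 1
  have h1 : ∀ t : ResidueSystem S, (sievedGap d t).card.choose j =
      (((gap d).powersetCard j).filter fun J : Finset ℤ =>
        ∀ p : S, ∀ h ∈ J, t p + (h : ZMod (p : ℕ)) ≠ 0).card := by
    intro t
    rw [← Finset.card_powersetCard]
    congr 1
    ext J
    simp only [Finset.mem_powersetCard, Finset.mem_filter, sievedGap, Finset.subset_iff]
    constructor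
    · rintro ⟨h1, h2⟩
      exact ⟨⟨fun x hx => (h1 hx).1, h2⟩, fun p h hh => (h1 hh).2 p⟩
    · rintro ⟨⟨h1, h2⟩, h3⟩
      exact ⟨fun x hx => ⟨h1 hx, fun p => h3 p x hx⟩, h2⟩
  simp only [h1, Finset.card_filter, Finset.sum_filter]
  rw [Finset.sum_comm]
  refine Finset.sum_congr rfl fun t _ => ?_
  split_ifs with h
  · refine Finset.sum_congr rfl fun J _ => ?_
    refine if_congr ?_ rfl rfl
    simp only [Finset.mem_union]
    constructor
    · exact fun h2 p a ha => h2 p a (Or.inr ha)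
    · rintro h2 p a (ha | ha)
      · exact h p a ha
      · exact h2 p a ha
  · refine Finset.sum_eq_zero fun J _ => if_neg fun h2 => h fun p a ha => h2 p a ?_
    exact Finset.mem_union_left _ ha

lemma choose_le_of_abs_sub_le {M j : ℕ} {α L P : ℝ} (h : |(M : ℝ) - α * L| ≤ α * P) :
    (M.choose j : ℝ) ≤ α ^ j * ((L + P) ^ j / j.factorial) := by
  refine (Nat.choose_le_pow_div j M).trans ?_
  rw [mul_div_assoc', ← mul_pow]
  refine div_le_div_of_nonneg_right ?_ (Nat.cast_nonneg _)
  exact pow_le_pow_left₀ (Nat.cast_nonneg _) (by linarith [(abs_le.1 h).2]) j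

lemma le_choose_of_abs_sub_le {M j : ℕ} {α L P : ℝ} (hα : 0 < α) (hα1 : 1 ≤ α * P)
    (hL : (j + 1) * P ≤ L) (h : |(M : ℝ) - α * L| ≤ α * P) :
    α ^ j * ((L - (j + 1) * P) ^ j / j.factorial) ≤ (M.choose j : ℝ) := by
  refine le_trans ?_ (Nat.pow_le_choose j M)
  rw [mul_div_assoc', ← mul_pow]
  refine div_le_div_of_nonneg_right ?_ (Nat.cast_nonneg _)
  refine pow_le_pow_left₀ (mul_nonneg hα.le (by linarith)) ?_ j
  have h1 : (M : ℝ) + 1 - j ≤ ((M + 1 - j : ℕ) : ℝ) := by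
    have : M + 1 ≤ (M + 1 - j) + j := by omega
    have : ((M + 1 : ℕ) : ℝ) ≤ ((M + 1 - j) + j : ℕ) := by exact_mod_cast this
    push_cast at this ⊢
    linarith
  refine le_trans ?_ h1
  have h2 := (abs_le.1 h).1
  -- The loss of `j` in `M + 1 - j` is absorbed into the error `α P`, which is at least `1`.
  have h3 : (j : ℝ) ≤ j * (α * P) := le_mul_of_one_le_right (Nat.cast_nonneg _) hα1
  nlinarith

lemma disjoint_pairSet_of_subset_gap {d : ℕ} {J : Finset ℤ} (hJ : J ⊆ gap d) :
    Disjoint (pairSet d) J := by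
  rw [Finset.disjoint_left]
  intro b hb hb2
  have := hJ hb2
  rw [mem_gap] at this
  rw [mem_pairSet] at hb
  omega

lemma card_pairSet_union {d j : ℕ} (hd : 0 < d) {J : Finset ℤ}
    (hJ : J ∈ (gap d).powersetCard j) : (pairSet d ∪ J).card = j + 2 := by
  obtain ⟨h1, h2⟩ := Finset.mem_powersetCard.1 hJ
  rw [Finset.card_union_of_disjoint (disjoint_pairSet_of_subset_gap h1), card_pairSet hd, h2,
    add_comm]

/-- Every sieved interval has about `α d` elements, hence about `α^j d^j / j!` subsets of size `j`.
The power `α^j` cancels the normalisation of the `j` added points, and the number of admitted `t`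
restores the local factors of the pair. -/
lemma exists_sum_prod_localFactor_bounds {S : Finset ℕ} (hS : ∀ p ∈ S, p.Prime) (j : ℕ) :
    ∃ K : ℝ, 0 ≤ K ∧ ∀ d : ℕ, 0 < d → K ≤ d →
      (d - K) ^ j / j.factorial * ∏ p ∈ S, localFactor (pairSet d) p ≤
        ∑ J ∈ (gap d).powersetCard j, ∏ p ∈ S, localFactor (pairSet d ∪ J) p ∧
      ∑ J ∈ (gap d).powersetCard j, ∏ p ∈ S, localFactor (pairSet d ∪ J) p ≤
        (d + K) ^ j / j.factorial * ∏ p ∈ S, localFactor (pairSet d) p := by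
  have hF : ∀ p : S, Fact (p : ℕ).Prime := fun p => ⟨hS p p.2⟩
  set P : ℝ := ∏ p ∈ S, (p : ℝ) with hPdef
  set α : ℝ := ∏ p ∈ S, (1 - 1 / (p : ℝ)) with hαdef
  have hP : 0 < P := Finset.prod_pos fun p hp => by exact_mod_cast (hS p hp).pos
  have hα : 0 < α := Finset.prod_pos fun p hp => sub_pos.2 (one_div_prime_lt_one (hS p hp))
  have hαP : 1 ≤ α * P := by
    rw [hPdef, hαdef, ← Finset.prod_mul_distrib]
    refine Finset.one_le_prod fun p hp => ?_
    have : (2 : ℝ) ≤ p := by exact_mod_cast (hS p hp).two_le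
    rw [sub_mul, one_div_mul_cancel (by linarith)]
    linarith
  -- The extra `1` accounts for `gap d` having `d - 1` elements.
  refine ⟨(j + 1) * P + 1, by positivity, fun d hd hdK => ?_⟩
  have hd1 : (1 : ℝ) ≤ d := by exact_mod_cast hd
  set D := Finset.univ.filter fun t : ResidueSystem S =>
    ∀ p : S, ∀ h ∈ pairSet d, t p + (h : ZMod (p : ℕ)) ≠ 0 with hD
  have hprod : ∀ H : Finset ℤ, ∏ p ∈ S, localFactor H p =
      (α ^ H.card)⁻¹ * ∏ p ∈ S, (1 - (residueCount H p : ℝ) / p) := by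
    intro H
    simp only [localFactor]
    rw [Finset.prod_mul_distrib, hαdef, ← Finset.prod_pow, ← Finset.prod_inv_distrib]
  have hpair : ∏ p ∈ S, localFactor (pairSet d) p = (α ^ 2)⁻¹ * (P⁻¹ * D.card) := by
    rw [hprod, card_pairSet hd, hD, card_residueSystem_filter_forall, ← hPdef,
      inv_mul_cancel_left₀ hP.ne']
  have hsum : ∑ J ∈ (gap d).powersetCard j, ∏ p ∈ S, localFactor (pairSet d ∪ J) p =
      (α ^ 2)⁻¹ * (P⁻¹ * ∑ t ∈ D, (α ^ j)⁻¹ * ((sievedGap d t).card.choose j : ℝ)) := by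
    rw [← Finset.mul_sum, hD, ← sum_powersetCard_prod_one_sub d j, ← hPdef,
      mul_left_comm P⁻¹, inv_mul_cancel_left₀ hP.ne', ← mul_assoc, ← mul_inv, ← pow_add,
      Finset.mul_sum]
    refine Finset.sum_congr rfl fun J hJ => ?_
    rw [hprod, card_pairSet_union hd hJ, add_comm]
  have hterm : ∀ t ∈ D, (d - ((j + 1) * P + 1)) ^ j / j.factorial ≤
      (α ^ j)⁻¹ * ((sievedGap d t).card.choose j : ℝ) ∧
      (α ^ j)⁻¹ * ((sievedGap d t).card.choose j : ℝ) ≤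
        (d + ((j + 1) * P + 1)) ^ j / j.factorial := by
    intro t _
    have habs := abs_card_sievedGap_sub_le hS hd t
    have hαj : 0 < α ^ j := pow_pos hα j
    constructor
    · rw [le_inv_mul_iff₀ hαj]
      have := le_choose_of_abs_sub_le (j := j) hα hαP (by linarith) habs
      have e : (d : ℝ) - ((j + 1) * P + 1) = d - 1 - (j + 1) * P := by ring
      rwa [e]
    · rw [inv_mul_le_iff₀ hαj]
      refine (choose_le_of_abs_sub_le (j := j) habs).trans ?_
      refine mul_le_mul_of_nonneg_left ?_ hαj.le
      refine div_le_div_of_nonneg_right ?_ (Nat.cast_nonneg _)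
      refine pow_le_pow_left₀ (by linarith) ?_ j
      have : (0 : ℝ) ≤ j * P := by positivity
      linarith
  have hc : 0 ≤ (α ^ 2)⁻¹ := by positivity
  have hPi : 0 ≤ P⁻¹ := by positivity
  rw [hsum, hpair]
  have hre : ∀ A : ℝ, A * ((α ^ 2)⁻¹ * (P⁻¹ * D.card)) = (α ^ 2)⁻¹ * (P⁻¹ * (D.card * A)) :=
    fun A => by ring
  rw [hre, hre]
  constructor <;> refine mul_le_mul_of_nonneg_left (mul_le_mul_of_nonneg_left ?_ hPi) hc <;>
    rw [← nsmul_eq_mul]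
  · exact Finset.card_nsmul_le_sum _ _ _ fun t ht => (hterm t ht).1
  · exact Finset.sum_le_card_nsmul _ _ _ fun t ht => (hterm t ht).2

/-! ### Large primes: the effect of adjoining `J` -/

lemma localFactor_pairSet_union {d j : ℕ} (hd : 0 < d) {J : Finset ℤ}
    (hJ : J ∈ (gap d).powersetCard j) (p : ℕ) :
    localFactor (pairSet d ∪ J) p = ((1 - 1 / (p : ℝ)) ^ 2)⁻¹ *
      (eulerPow j p * (1 - (residueCount (pairSet d ∪ J) p : ℝ) / p)) := by
  rw [localFactor, card_pairSet_union hd hJ, eulerPow, pow_add, mul_inv]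
  ring

lemma residueCount_pairSet_le_union (d p : ℕ) (J : Finset ℤ) :
    residueCount (pairSet d) p ≤ residueCount (pairSet d ∪ J) p :=
  Finset.card_le_card (Finset.image_subset_image Finset.subset_union_left)

lemma residueCount_union_le (D J : Finset ℤ) (p : ℕ) :
    residueCount (D ∪ J) p ≤ residueCount D p + J.card := by
  rw [residueCount, Finset.image_union]
  exact (Finset.card_union_le _ _).trans (Nat.add_le_add_left Finset.card_image_le _)

lemma residueCount_union_of_not_exceptional {d p : ℕ} {J : Finset ℤ} (hJ : J ⊆ gap d)
    (h : ¬ Exceptional d J p) :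
    residueCount (pairSet d ∪ J) p = residueCount (pairSet d) p + J.card := by
  have hne : ∀ a ∈ J, ∀ b ∈ pairSet d ∪ J, (a : ZMod p) = b → a = b := by
    intro a ha b hb hab
    by_contra hne
    rw [eq_comm, ZMod.intCast_eq_intCast_iff_dvd_sub] at hab
    exact h ⟨a, ha, b, Finset.mem_erase.2 ⟨fun e => hne e.symm, hb⟩, hab⟩
  rw [residueCount, Finset.image_union, Finset.card_union_of_disjoint, residueCount,
    Finset.card_image_of_injOn (s := J)]
  · intro a ha b hb hab
    exact hne a ha b (Finset.mem_union_right _ hb) hab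
  · rw [Finset.disjoint_left]
    intro x hx hx2
    obtain ⟨b, hb, rfl⟩ := Finset.mem_image.1 hx
    obtain ⟨a, ha, hab⟩ := Finset.mem_image.1 hx2
    have := hne a ha b (Finset.mem_union_left _ hb) hab
    subst this
    exact Finset.disjoint_left.1 (disjoint_pairSet_of_subset_gap hJ) hb ha

lemma Exceptional.le {d p : ℕ} {J : Finset ℤ} (hJ : J ⊆ gap d) (h : Exceptional d J p) :
    p ≤ d := by
  obtain ⟨a, ha, b, hb, hab⟩ := h
  rw [Finset.mem_erase, Finset.mem_union, mem_pairSet] at hb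
  have ha := mem_gap.1 (hJ ha)
  have hb2 : 1 ≤ b ∧ b ≤ d + 1 := by
    rcases hb.2 with (h | h) | h
    · omega
    · omega
    · have := mem_gap.1 (hJ h); omega
  have := Nat.le_of_dvd (by omega) (Int.natCast_dvd.1 hab)
  omega

-- At a non-exceptional prime the residue count `ν` grows by exactly `j`, and `1 - (ν + j)/p ≤ (1 -
-- 1/p)^j (1 - ν/p)` by Bernoulli. At an exceptional prime only `ν` not decreasing is used, which
-- costs the full normalising factor.
open Classical in
lemma localFactor_union_le {d j : ℕ} (hd : 0 < d) {J : Finset ℤ}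
    (hJ : J ∈ (gap d).powersetCard j) {p : ℕ} (hp : p.Prime) :
    localFactor (pairSet d ∪ J) p ≤
      localFactor (pairSet d) p * if Exceptional d J p then eulerPow j p else 1 := by
  have hp0 : (0 : ℝ) < p := by exact_mod_cast hp.pos
  have hu1 := one_div_prime_lt_one hp
  have hu0 := one_div_prime_pos hp
  have hw := one_sub_residueCount_div_nonneg (pairSet d) hp
  have he := one_le_eulerPow j hp
  rw [localFactor_pairSet_union hd hJ, localFactor, card_pairSet hd, mul_assoc]
  refine mul_le_mul_of_nonneg_left ?_ (inv_nonneg.2 (pow_nonneg (by linarith) 2))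
  split_ifs with h
  · rw [mul_comm]
    refine mul_le_mul_of_nonneg_right ?_ (by linarith)
    have := residueCount_pairSet_le_union d p J
    gcongr
  · obtain ⟨hJ1, hJ2⟩ := Finset.mem_powersetCard.1 hJ
    rw [residueCount_union_of_not_exceptional hJ1 h, hJ2, mul_one, eulerPow,
      inv_mul_le_iff₀ (pow_pos (by linarith) j)]
    have h1 := mul_le_mul_of_nonneg_right (one_sub_mul_le_pow hu1.le j) hw
    refine le_trans ?_ h1
    have h2 : 0 ≤ ((j : ℝ) * (1 / p)) * (residueCount (pairSet d) p / p) := by positivity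
    have h3 : (((residueCount (pairSet d) p + j : ℕ) : ℝ)) / p =
        residueCount (pairSet d) p / p + j * (1 / p) := by
      push_cast; ring
    rw [h3]
    nlinarith

/-- The count `ν` grows by at most `j`, and with `u = 1/p` one has `(1 + ju)(1 - νu - ju) = (1 - νu)
- (νj + j^2)u^2`. The factor `3` comes from `1 - νu ≥ 1/3`, valid for `ν ≤ 2` and `p ≥ 3`. -/
lemma le_localFactor_union {d j : ℕ} (hd : 0 < d) {J : Finset ℤ}
    (hJ : J ∈ (gap d).powersetCard j) {p : ℕ} (hp : p.Prime) (h2 : 2 < p) :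
    localFactor (pairSet d) p * (1 - 3 * (2 * j + j ^ 2) * ((p : ℝ) ^ 2)⁻¹) ≤
      localFactor (pairSet d ∪ J) p := by
  have hp0 : (0 : ℝ) < p := by exact_mod_cast hp.pos
  have hp3 : (3 : ℝ) ≤ p := by exact_mod_cast h2
  have hu1 := one_div_prime_lt_one hp
  have hu0 := one_div_prime_pos hp
  rw [localFactor_pairSet_union hd hJ, localFactor, card_pairSet hd, mul_assoc]
  refine mul_le_mul_of_nonneg_left ?_ (inv_nonneg.2 (pow_nonneg (by linarith) 2))
  have hν : residueCount (pairSet d ∪ J) p ≤ residueCount (pairSet d) p + j := by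
    have := residueCount_union_le (pairSet d) J p
    rwa [(Finset.mem_powersetCard.1 hJ).2] at this
  have hν' : (residueCount (pairSet d ∪ J) p : ℝ) ≤ residueCount (pairSet d) p + j := by
    exact_mod_cast hν
  have hD : (residueCount (pairSet d) p : ℝ) ≤ 2 := by
    have := residueCount_le_card (pairSet d) p
    rw [card_pairSet hd] at this
    exact_mod_cast this
  set u : ℝ := 1 / p with hu
  have hu3 : u ≤ 1 / 3 := one_div_le_one_div_of_le (by norm_num) hp3
  have hsq : ((p : ℝ) ^ 2)⁻¹ = u ^ 2 := by rw [hu, one_div, inv_pow]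
  have hdiv : ∀ a : ℝ, a / p = a * u := fun a => by rw [hu, mul_one_div]
  have hH0 := one_sub_residueCount_div_nonneg (pairSet d ∪ J) hp
  rw [hdiv] at hH0
  rw [hsq, hdiv, hdiv]
  have hD0 : (0 : ℝ) ≤ residueCount (pairSet d) p := Nat.cast_nonneg _
  set v : ℝ := (residueCount (pairSet d) p : ℝ)
  set v' : ℝ := (residueCount (pairSet d ∪ J) p : ℝ)
  have h1 : (1 + j * u) * (1 - v' * u) ≤ eulerPow j p * (1 - v' * u) :=
    mul_le_mul_of_nonneg_right (one_add_mul_le_inv_pow hu0.le hu1 j) hH0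
  refine le_trans ?_ h1
  have hj : (0 : ℝ) ≤ j := Nat.cast_nonneg j
  have h4 : (1 + j * u) * (1 - v * u - j * u) ≤ (1 + j * u) * (1 - v' * u) := by
    refine mul_le_mul_of_nonneg_left ?_ (by positivity)
    nlinarith
  refine le_trans ?_ h4
  have hw : 1 / 3 ≤ 1 - v * u := by nlinarith
  have h5 : 0 ≤ j * u ^ 2 := by positivity
  have h6 : 0 ≤ (2 * (j : ℝ) + j ^ 2) * u ^ 2 := by positivity
  nlinarith [mul_le_mul_of_nonneg_right hw h6, mul_le_mul_of_nonneg_right hD h5]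

lemma one_sub_sum_le_prod_one_sub {ι : Type*} (s : Finset ι) {f : ι → ℝ}
    (h0 : ∀ i ∈ s, 0 ≤ f i) (h1 : ∀ i ∈ s, f i ≤ 1) :
    1 - ∑ i ∈ s, f i ≤ ∏ i ∈ s, (1 - f i) := by
  classical
  induction s using Finset.induction_on with
  | empty => simp
  | insert a s ha ih =>
    rw [Finset.sum_insert ha, Finset.prod_insert ha]
    have hi := ih (fun i hi => h0 i (Finset.mem_insert_of_mem hi))
      fun i hi => h1 i (Finset.mem_insert_of_mem hi)
    have hs : 0 ≤ ∑ i ∈ s, f i :=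
      Finset.sum_nonneg fun i hi => h0 i (Finset.mem_insert_of_mem hi)
    have ha0 := h0 a (Finset.mem_insert_self a s)
    have ha1 := h1 a (Finset.mem_insert_self a s)
    nlinarith [mul_le_mul_of_nonneg_left hi (sub_nonneg.2 ha1)]

lemma prod_primesBelow_succ (f : ℕ → ℝ) {y m : ℕ} (h : y ≤ m) :
    ∏ p ∈ (m + 1).primesBelow, f p =
      (∏ p ∈ (y + 1).primesBelow, f p) * ∏ p ∈ primesBetween y m, f p := by
  rw [← Finset.prod_union]
  · congr 1
    ext p
    simp only [Nat.mem_primesBelow, Finset.mem_union, mem_primesBetween]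
    constructor
    · rintro ⟨h1, h2⟩
      rcases le_or_gt p y with h3 | h3
      · exact Or.inl ⟨by omega, h2⟩
      · exact Or.inr ⟨⟨h3, by omega⟩, h2⟩
    · rintro (⟨h1, h2⟩ | ⟨⟨h1, h3⟩, h2⟩)
      · exact ⟨by omega, h2⟩
      · exact ⟨by omega, h2⟩
  · rw [Finset.disjoint_left]
    intro p hp hp2
    rw [Nat.mem_primesBelow] at hp
    rw [mem_primesBetween] at hp2
    omega

/-- The partial product of the singular series over the primes `p ≤ y`. -/
noncomputable def partialSeries (y : ℕ) (H : Finset ℤ) : ℝ :=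
  ∏ p ∈ (y + 1).primesBelow, localFactor H p

lemma partialSeries_nonneg (y : ℕ) (H : Finset ℤ) : 0 ≤ partialSeries y H :=
  Finset.prod_nonneg fun _ hp => localFactor_nonneg H (Nat.prime_of_mem_primesBelow hp)

lemma tendsto_partialSeries (H : Finset ℤ) :
    Tendsto (fun y => partialSeries y H) atTop (𝓝 (tupleSingularSeries H)) :=
  (tendsto_prod_localFactor H).comp (tendsto_add_atTop_nat 1)

lemma localFactor_pairSet_pos {d : ℕ} (hd : 0 < d) (he : Even d) {p : ℕ} (hp : p.Prime) :
    0 < localFactor (pairSet d) p := by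
  rcases hp.two_le.eq_or_lt with rfl | h
  · rw [localFactor_pairSet_two hd he]; norm_num
  · have hle := residueCount_le_card (pairSet d) p
    rw [card_pairSet hd] at hle
    have hp0 : (0 : ℝ) < p := by exact_mod_cast hp.pos
    refine mul_pos (inv_pos.2 (pow_pos (sub_pos.2 (one_div_prime_lt_one hp)) _)) ?_
    rw [sub_pos, div_lt_one hp0]
    exact_mod_cast hle.trans_lt h

lemma partialSeries_pairSet_pos {d : ℕ} (hd : 0 < d) (he : Even d) (y : ℕ) :
    0 < partialSeries y (pairSet d) :=
  Finset.prod_pos fun _ hp => localFactor_pairSet_pos hd he (Nat.prime_of_mem_primesBelow hp)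

/-- Cross-multiplied because the partial product of `pairSet d ∪ J` may vanish. The inequality holds
for the products over `p ≤ m`, and the limit is taken in `m`. -/
lemma partialSeries_mul_tupleSingularSeries_ge {d j : ℕ} (hd : 0 < d) {J : Finset ℤ}
    (hJ : J ∈ (gap d).powersetCard j) {y : ℕ} (hy : 2 ≤ y) (hyj : 3 * (2 * j + j ^ 2) ≤ y) :
    partialSeries y (pairSet d ∪ J) *
        ((1 - 3 * (2 * j + j ^ 2) / y) * tupleSingularSeries (pairSet d)) ≤
      partialSeries y (pairSet d) * tupleSingularSeries (pairSet d ∪ J) := by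
  refine le_of_tendsto_of_tendsto
    (((tendsto_partialSeries (pairSet d)).const_mul _).const_mul _)
    ((tendsto_partialSeries (pairSet d ∪ J)).const_mul _) ?_
  filter_upwards [eventually_ge_atTop y] with m hm
  rw [partialSeries, partialSeries, partialSeries, partialSeries, prod_primesBelow_succ _ hm,
    prod_primesBelow_succ _ hm]
  have hC0 : (0 : ℝ) ≤ 3 * (2 * j + j ^ 2) := by positivity
  have hy' : (3 * (2 * j + j ^ 2) : ℝ) ≤ y := by exact_mod_cast hyj
  have h1 : 1 - 3 * (2 * j + j ^ 2) / (y : ℝ) ≤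
      ∏ p ∈ primesBetween y m, (1 - 3 * (2 * j + j ^ 2) * ((p : ℝ) ^ 2)⁻¹) := by
    refine le_trans ?_ (one_sub_sum_le_prod_one_sub _ (fun p _ => by positivity) fun p hp => ?_)
    · rw [← Finset.mul_sum]
      have := mul_le_mul_of_nonneg_left (sum_inv_sq_primesBetween_le (by omega : 0 < y) m) hC0
      rw [mul_one_div] at this
      linarith
    · have hp' := mem_primesBetween.1 hp
      have hyp : (y : ℝ) ≤ p := by exact_mod_cast hp'.1.1.le
      have hp1 : (1 : ℝ) ≤ p := by exact_mod_cast hp'.2.one_le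
      rw [← div_eq_mul_inv, div_le_one (by positivity)]
      nlinarith
  have h2 : (∏ p ∈ primesBetween y m, localFactor (pairSet d) p) *
      (1 - 3 * (2 * j + j ^ 2) / (y : ℝ)) ≤
      ∏ p ∈ primesBetween y m, localFactor (pairSet d ∪ J) p := by
    refine (mul_le_mul_of_nonneg_left h1 (Finset.prod_nonneg fun p hp =>
      localFactor_nonneg _ (mem_primesBetween.1 hp).2)).trans ?_
    rw [← Finset.prod_mul_distrib]
    refine Finset.prod_le_prod (fun p hp => ?_) fun p hp => ?_
    · refine mul_nonneg (localFactor_nonneg _ (mem_primesBetween.1 hp).2) ?_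
      have hp' := mem_primesBetween.1 hp
      have hyp : (y : ℝ) ≤ p := by exact_mod_cast hp'.1.1.le
      have hp1 : (1 : ℝ) ≤ p := by exact_mod_cast hp'.2.one_le
      rw [sub_nonneg, ← div_eq_mul_inv, div_le_one (by positivity)]
      nlinarith
    · have hp' := mem_primesBetween.1 hp
      exact le_localFactor_union hd hJ hp'.2 (by omega)
  have h3 := mul_le_mul_of_nonneg_left h2
    (mul_nonneg (partialSeries_nonneg y (pairSet d ∪ J)) (partialSeries_nonneg y (pairSet d)))
  rw [partialSeries, partialSeries] at h3
  linarith

lemma partialSeries_mul_tupleSingularSeries_le {d j : ℕ} (hd : 0 < d) {J : Finset ℤ}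
    (hJ : J ∈ (gap d).powersetCard j) (y : ℕ) :
    partialSeries y (pairSet d) * tupleSingularSeries (pairSet d ∪ J) ≤
      partialSeries y (pairSet d ∪ J) *
        (exceptionalWeight j y d J * tupleSingularSeries (pairSet d)) := by
  classical
  refine le_of_tendsto_of_tendsto ((tendsto_partialSeries (pairSet d ∪ J)).const_mul _)
    (((tendsto_partialSeries (pairSet d)).const_mul _).const_mul _) ?_
  filter_upwards [eventually_ge_atTop y, eventually_ge_atTop d] with m hm hmd
  rw [partialSeries, partialSeries, partialSeries, partialSeries, prod_primesBelow_succ _ hm,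
    prod_primesBelow_succ _ hm]
  have hJ1 := (Finset.mem_powersetCard.1 hJ).1
  -- No prime above `d` is exceptional, so the weight is already complete at `d`.
  have h1 : exceptionalWeight j y d J =
      ∏ p ∈ primesBetween y m, if Exceptional d J p then eulerPow j p else 1 := by
    rw [exceptionalWeight]
    refine Finset.prod_subset (fun p hp => ?_) fun p hp hp2 => if_neg fun hE => hp2 ?_
    · rw [mem_primesBetween] at hp ⊢
      exact ⟨⟨hp.1.1, by omega⟩, hp.2⟩
    · rw [mem_primesBetween] at hp ⊢
      exact ⟨⟨hp.1.1, hE.le hJ1⟩, hp.2⟩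
  have h2 : ∏ p ∈ primesBetween y m, localFactor (pairSet d ∪ J) p ≤
      (∏ p ∈ primesBetween y m, localFactor (pairSet d) p) * exceptionalWeight j y d J := by
    rw [h1, ← Finset.prod_mul_distrib]
    exact Finset.prod_le_prod
      (fun p hp => localFactor_nonneg _ (mem_primesBetween.1 hp).2)
      fun p hp => localFactor_union_le hd hJ (mem_primesBetween.1 hp).2
  have h3 := mul_le_mul_of_nonneg_left h2
    (mul_nonneg (partialSeries_nonneg y (pairSet d ∪ J)) (partialSeries_nonneg y (pairSet d)))
  rw [partialSeries, partialSeries] at h3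
  linarith

/-- A crude bound, needed only to control the second moment of the small-prime factor. Taking `1` as
the lower cutoff includes all primes up to `d`. -/
lemma partialSeries_union_le {d j : ℕ} (hd : 0 < d) {J : Finset ℤ}
    (hJ : J ∈ (gap d).powersetCard j) {y : ℕ} (hyd : y ≤ d) :
    partialSeries y (pairSet d ∪ J) ≤
      partialSeries y (pairSet d) * exceptionalWeight j 1 d J := by
  classical
  have hge : ∀ p : ℕ, p.Prime → 1 ≤ if Exceptional d J p then eulerPow j p else 1 := by
    intro p hp
    split_ifs
    · exact one_le_eulerPow j hp
    · exact le_rfl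
  have h1 : ∏ p ∈ (y + 1).primesBelow, (if Exceptional d J p then eulerPow j p else 1) ≤
      exceptionalWeight j 1 d J := by
    refine Finset.prod_le_prod_of_subset_of_one_le (fun p hp => ?_) (fun p hp => ?_)
      fun p hp _ => hge p (mem_primesBetween.1 hp).2
    · rw [Nat.mem_primesBelow] at hp
      rw [mem_primesBetween]
      exact ⟨⟨hp.2.one_lt, by omega⟩, hp.2⟩
    · exact zero_le_one.trans (hge p (Nat.prime_of_mem_primesBelow hp))
  refine le_trans ?_ (mul_le_mul_of_nonneg_left h1 (partialSeries_nonneg _ _))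
  rw [partialSeries, partialSeries, ← Finset.prod_mul_distrib]
  exact Finset.prod_le_prod
    (fun p hp => localFactor_nonneg _ (Nat.prime_of_mem_primesBelow hp))
    fun p hp => localFactor_union_le hd hJ (Nat.prime_of_mem_primesBelow hp)

/-! ### The mean value of the singular series -/

lemma mul_sub_one_le {a b η : ℝ} (hb : 1 ≤ b) (hη : 0 < η) :
    a * (b - 1) ≤ η / 2 * a ^ 2 + 1 / (2 * η) * (b ^ 2 - 1) := by
  have h1 : (b - 1) ^ 2 ≤ b ^ 2 - 1 := by nlinarith
  have h2 : 1 / (2 * η) * (b - 1) ^ 2 ≤ 1 / (2 * η) * (b ^ 2 - 1) :=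
    mul_le_mul_of_nonneg_left h1 (by positivity)
  refine le_trans ?_ (add_le_add_right h2 _)
  have h3 : η / 2 * a ^ 2 + 1 / (2 * η) * (b - 1) ^ 2 - a * (b - 1) =
      1 / (2 * η) * (η * a - (b - 1)) ^ 2 := by
    field_simp
    ring
  have h4 : 0 ≤ 1 / (2 * η) * (η * a - (b - 1)) ^ 2 := by positivity
  linarith

/-- Both squares produced by `mul_sub_one_le` are exceptional weights with doubled exponent: the one
cut at `1` has bounded mean and is multiplied by a small `η`, the one cut at `y` has small mean
excess. -/
lemma sum_partialSeries_mul_exceptionalWeight_sub_one_le (j : ℕ) {y d : ℕ} (hy : 0 < y)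
    (hd : 2 ≤ d) (hyd : y ≤ d) {η : ℝ} (hη : 0 < η) :
    ∑ J ∈ (gap d).powersetCard j,
        partialSeries y (pairSet d ∪ J) * (exceptionalWeight j y d J - 1) ≤
      partialSeries y (pairSet d) *
        ((η / 2 * (12 * divisorExcess (j * 2 * (j * (j + 2))) 1 + 1) +
          1 / (2 * η) * (12 * divisorExcess (j * 2 * (j * (j + 2))) y)) * d ^ j) := by
  have hterm : ∀ J ∈ (gap d).powersetCard j,
      partialSeries y (pairSet d ∪ J) * (exceptionalWeight j y d J - 1) ≤
      partialSeries y (pairSet d) * (η / 2 * ((exceptionalWeight (j * 2) 1 d J - 1) + 1) +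
        1 / (2 * η) * (exceptionalWeight (j * 2) y d J - 1)) := by
    intro J hJ
    have h1 := one_le_exceptionalWeight j y d J
    rw [sub_add_cancel, ← exceptionalWeight_pow, ← exceptionalWeight_pow]
    refine (mul_le_mul_of_nonneg_right (partialSeries_union_le (by omega) hJ hyd)
      (sub_nonneg.2 h1)).trans ?_
    rw [mul_assoc]
    exact mul_le_mul_of_nonneg_left (mul_sub_one_le h1 hη) (partialSeries_nonneg _ _)
  refine (Finset.sum_le_sum hterm).trans ?_
  rw [← Finset.mul_sum]
  refine mul_le_mul_of_nonneg_left ?_ (partialSeries_nonneg _ _)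
  rw [Finset.sum_add_distrib, ← Finset.mul_sum, ← Finset.mul_sum, Finset.sum_add_distrib]
  have h1 := sum_exceptionalWeight_sub_one_le (j * 2) j one_pos hd
  have h2 := sum_exceptionalWeight_sub_one_le (j * 2) j hy hd
  have h3 : ∑ _J ∈ (gap d).powersetCard j, (1 : ℝ) ≤ d ^ j := by
    rw [Finset.sum_const, nsmul_eq_mul, mul_one, Finset.card_powersetCard, card_gap]
    exact_mod_cast (Nat.choose_le_pow _ _).trans (Nat.pow_le_pow_left (Nat.sub_le _ _) j)
  have h4 := mul_le_mul_of_nonneg_left (add_le_add h1 h3) (by positivity : 0 ≤ η / 2)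
  have h5 := mul_le_mul_of_nonneg_left h2 (by positivity : 0 ≤ 1 / (2 * η))
  linarith

lemma tendsto_add_const_pow_div_pow (K : ℝ) (j : ℕ) :
    Tendsto (fun d : ℕ => ((d : ℝ) + K) ^ j / (d : ℝ) ^ j) atTop (𝓝 1) := by
  have h : Tendsto (fun d : ℕ => (1 + K / (d : ℝ)) ^ j) atTop (𝓝 ((1 + 0) ^ j)) :=
    ((tendsto_const_div_atTop_nhds_zero_nat K).const_add 1).pow j
  rw [add_zero, one_pow] at h
  refine h.congr' ?_
  filter_upwards [eventually_gt_atTop 0] with d hd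
  have : (d : ℝ) ≠ 0 := by exact_mod_cast hd.ne'
  rw [← div_pow, add_div, div_self this]

/-- The mean value of the singular series of the sets `pairSet d ∪ J`, where `J` runs over the
`j`-element subsets of `gap d`. -/
theorem eventually_abs_sum_tupleSingularSeries_sub_le (j : ℕ) {ε : ℝ} (hε : 0 < ε) :
    ∀ᶠ d : ℕ in atTop, Even d →
      |∑ J ∈ (gap d).powersetCard j, tupleSingularSeries (pairSet d ∪ J) -
        tupleSingularSeries (pairSet d) * (d ^ j / j.factorial)| ≤
      ε * (tupleSingularSeries (pairSet d) * d ^ j) := by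
  set k := j * 2 * (j * (j + 2))
  set A : ℝ := 12 * divisorExcess k 1 + 1 with hA
  have hA0 : 0 < A := by have := divisorExcess_nonneg k 1; positivity
  -- The first error term becomes `η A / 2 = ε / 2`. Then `y` is chosen in terms of `η`, and finally
  -- `d` in terms of `y`, through `K`.
  set η : ℝ := ε / A with hη
  have hη0 : 0 < η := by positivity
  have hev : ∀ᶠ y : ℕ in atTop, 1 / (2 * η) * (12 * divisorExcess k y) < ε / 4 := by
    have h := ((tendsto_divisorExcess k).const_mul 12).const_mul (1 / (2 * η))
    simp only [mul_zero] at h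
    exact h.eventually_lt_const (by positivity)
  have hev2 : ∀ᶠ y : ℕ in atTop, (3 * (2 * j + j ^ 2) : ℝ) / y < ε / 4 :=
    (tendsto_const_div_atTop_nhds_zero_nat _).eventually_lt_const (by positivity)
  obtain ⟨y, ⟨⟨hy1, hy2⟩, hy3⟩, hy4⟩ := (((hev.and hev2).and (eventually_ge_atTop 2)).and
    (eventually_ge_atTop (3 * (2 * j + j ^ 2)))).exists
  obtain ⟨K, hK0, hK⟩ := exists_sum_prod_localFactor_bounds (S := (y + 1).primesBelow)
    (fun p hp => Nat.prime_of_mem_primesBelow hp) j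
  filter_upwards [(tendsto_add_const_pow_div_pow K j).eventually_lt_const
      (show (1 : ℝ) < 1 + ε / 4 by linarith),
    (tendsto_add_const_pow_div_pow (-K) j).eventually_const_lt
      (show 1 - ε / 4 < (1 : ℝ) by linarith),
    eventually_ge_atTop y, eventually_ge_atTop ⌈K⌉₊] with d hd1 hd2 hdy hdK he
  have hd0 : 0 < d := by omega
  have hd0' : (0 : ℝ) < d := by exact_mod_cast hd0
  have hdj : (0 : ℝ) < (d : ℝ) ^ j := pow_pos hd0' j
  rw [div_lt_iff₀ hdj] at hd1
  rw [lt_div_iff₀ hdj, ← sub_eq_add_neg] at hd2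
  obtain ⟨hlo, hup⟩ := hK d hd0 (Nat.ceil_le.1 hdK)
  have hL : 0 < partialSeries y (pairSet d) := partialSeries_pairSet_pos hd0 he y
  have hS := tupleSingularSeries_nonneg (pairSet d)
  change _ * partialSeries y (pairSet d) ≤
    ∑ J ∈ (gap d).powersetCard j, partialSeries y (pairSet d ∪ J) at hlo
  change ∑ J ∈ (gap d).powersetCard j, partialSeries y (pairSet d ∪ J) ≤
    _ * partialSeries y (pairSet d) at hup
  set L := partialSeries y (pairSet d)
  set S := tupleSingularSeries (pairSet d)
  set T₀ := ∑ J ∈ (gap d).powersetCard j, partialSeries y (pairSet d ∪ J)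
  set T₁ := ∑ J ∈ (gap d).powersetCard j, tupleSingularSeries (pairSet d ∪ J)
  have hf1 : (1 : ℝ) ≤ j.factorial := by exact_mod_cast Nat.one_le_iff_ne_zero.2 j.factorial_ne_zero
  have hq : ∀ a : ℝ, 0 ≤ a → a / (j.factorial : ℝ) ≤ a := fun a ha => div_le_self ha hf1
  have hupper : T₁ ≤ S * ((d + K) ^ j / j.factorial + 3 * ε / 4 * d ^ j) := by
    have h1 : L * T₁ ≤ (T₀ + ∑ J ∈ (gap d).powersetCard j,
        partialSeries y (pairSet d ∪ J) * (exceptionalWeight j y d J - 1)) * S := by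
      rw [Finset.mul_sum, ← Finset.sum_add_distrib, Finset.sum_mul]
      refine Finset.sum_le_sum fun J hJ => ?_
      refine (partialSeries_mul_tupleSingularSeries_le hd0 hJ y).trans (le_of_eq ?_)
      ring
    have h2 := sum_partialSeries_mul_exceptionalWeight_sub_one_le j (y := y) (d := d) (by omega)
      (by omega) hdy hη0
    have h3 : η / 2 * A = ε / 2 := by rw [hη]; field_simp
    have h4 : (η / 2 * A + 1 / (2 * η) * (12 * divisorExcess k y)) * (d : ℝ) ^ j ≤
        3 * ε / 4 * d ^ j := mul_le_mul_of_nonneg_right (by linarith) hdj.le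
    have h5 := mul_le_mul_of_nonneg_right
      (add_le_add hup (h2.trans (mul_le_mul_of_nonneg_left h4 hL.le))) hS
    refine le_of_mul_le_mul_left (h1.trans (h5.trans (le_of_eq ?_))) hL
    ring
  have hlower : S * ((1 - 3 * (2 * j + j ^ 2) / y) * ((d - K) ^ j / j.factorial)) ≤ T₁ := by
    have h1 : T₀ * ((1 - 3 * (2 * j + j ^ 2) / y) * S) ≤ L * T₁ := by
      rw [Finset.mul_sum, Finset.sum_mul]
      exact Finset.sum_le_sum fun J hJ =>
        partialSeries_mul_tupleSingularSeries_ge hd0 hJ hy3 hy4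
    have hc : 0 ≤ 1 - 3 * (2 * j + j ^ 2) / (y : ℝ) := by
      rw [sub_nonneg, div_le_one (by exact_mod_cast (by omega : 0 < y))]
      exact_mod_cast hy4
    have h2 := mul_le_mul_of_nonneg_right hlo (mul_nonneg hc hS)
    refine le_of_mul_le_mul_left (le_trans (le_of_eq ?_) (h2.trans h1)) hL
    ring
  have hSd : 0 ≤ S * (d : ℝ) ^ j := mul_nonneg hS hdj.le
  rw [abs_le]
  constructor
  · have hc : 3 * (2 * j + j ^ 2) / (y : ℝ) ≤ ε / 4 := hy2.le
    have hdK0 : 0 ≤ ((d : ℝ) - K) ^ j := pow_nonneg (sub_nonneg.2 (Nat.ceil_le.1 hdK)) j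
    have hdKd : ((d : ℝ) - K) ^ j ≤ d ^ j :=
      pow_le_pow_left₀ (sub_nonneg.2 (Nat.ceil_le.1 hdK)) (by linarith) j
    have h1 : (d : ℝ) ^ j / j.factorial - (d - K) ^ j / j.factorial ≤ ε / 4 * d ^ j := by
      rw [← sub_div]
      exact (hq _ (by linarith)).trans (by linarith)
    have h2 : 3 * (2 * j + j ^ 2) / (y : ℝ) * ((d - K) ^ j / j.factorial) ≤ ε / 4 * d ^ j :=
      mul_le_mul hc ((hq _ hdK0).trans hdKd) (div_nonneg hdK0 (by linarith)) (by positivity)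
    have h3 := mul_le_mul_of_nonneg_left (add_le_add h1 h2) hS
    nlinarith
  · have h1 : ((d : ℝ) + K) ^ j / j.factorial - d ^ j / j.factorial ≤ ε / 4 * d ^ j := by
      rw [← sub_div]
      have : (d : ℝ) ^ j ≤ (d + K) ^ j := pow_le_pow_left₀ hd0'.le (by linarith) j
      exact (hq _ (by linarith)).trans (by linarith)
    have h3 := mul_le_mul_of_nonneg_left h1 hS
    nlinarith

/-! ### Bonferroni's inequality and the two ways of counting gaps -/

/-- For positive `M` and `m` the truncated sum is `±C(M-1, m-1)`, at most the first omitted term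
`C(M, m)`. -/
lemma abs_indicator_sub_alternating_sum_le (M m : ℕ) :
    |(if M = 0 then (1 : ℝ) else 0) - ∑ j ∈ Finset.range m, (-1) ^ j * (M.choose j : ℝ)| ≤
      M.choose m := by
  rcases m with _ | m
  · simp only [Finset.range_zero, Finset.sum_empty, sub_zero, Nat.choose_zero_right, Nat.cast_one]
    split_ifs <;> simp
  rcases M with _ | M
  · rw [Finset.sum_range_succ']
    simp
  · have h := congrArg (Int.cast (R := ℝ))
      (Int.alternating_sum_range_choose_eq_choose (n := M) (m := m))
    push_cast at h
    rw [h, if_neg (Nat.succ_ne_zero M), zero_sub, abs_neg, abs_mul, abs_pow, abs_neg, abs_one,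
      one_pow, one_mul, Nat.abs_cast, Nat.choose_succ_succ]
    exact_mod_cast Nat.le_add_right _ _

/-- The integer `z` is a positive prime. -/
def IsPositivePrime (z : ℤ) : Prop := ∃ p : ℕ, p.Prime ∧ z = (p : ℤ)

open Classical in
/-- The positive integers `n ≤ x` such that all `n + a`, `a ∈ H`, are primes. -/
noncomputable def tuplePoints (x : ℝ) (H : Finset ℤ) : Finset ℕ :=
  (Finset.Icc 1 ⌊x⌋₊).filter fun n => ∀ a ∈ H, IsPositivePrime (n + a)

open Classical in
/-- The elements `h` of `gap d` such that `n + h` is prime. -/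
noncomputable def primeGap (d n : ℕ) : Finset ℤ :=
  (gap d).filter fun h => IsPositivePrime (n + h)

lemma mem_tuplePoints {x : ℝ} {H : Finset ℤ} {n : ℕ} :
    n ∈ tuplePoints x H ↔ (1 ≤ n ∧ n ≤ ⌊x⌋₊) ∧ ∀ a ∈ H, IsPositivePrime (n + a) := by
  classical
  rw [tuplePoints, Finset.mem_filter, Finset.mem_Icc]

lemma mem_primeGap {d n : ℕ} {h : ℤ} :
    h ∈ primeGap d n ↔ h ∈ gap d ∧ IsPositivePrime (n + h) := by
  classical
  rw [primeGap, Finset.mem_filter]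

lemma strictMono_nth_prime : StrictMono (Nat.nth Nat.Prime) :=
  Nat.nth_strictMono Nat.infinite_setOfPred_prime

lemma tupleCount_eq_card (x : ℝ) (H : Finset ℤ) : tupleCount x H = (tuplePoints x H).card := by
  rw [tupleCount, ← Set.ncard_coe_finset]
  congr 1
  ext n
  rw [Finset.mem_coe, mem_tuplePoints]
  constructor
  · rintro ⟨h1, h2, h3⟩
    exact ⟨⟨h1, (Nat.le_floor_iff' (by omega)).2 h2⟩, h3⟩
  · rintro ⟨⟨h1, h2⟩, h3⟩
    exact ⟨h1, (Nat.le_floor_iff' (by omega)).1 h2, h3⟩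

/-- Both sides count pairs `(n, J)` with `J` a `j`-element set of positions in the gap at which `n +
h` is prime. -/
lemma sum_tupleCount_eq (x : ℝ) (d j : ℕ) :
    ∑ J ∈ (gap d).powersetCard j, tupleCount x (pairSet d ∪ J) =
      ∑ n ∈ tuplePoints x (pairSet d), (primeGap d n).card.choose j := by
  classical
  have h1 : ∀ n, (primeGap d n).card.choose j =
      (((gap d).powersetCard j).filter fun J => ∀ h ∈ J, IsPositivePrime (n + h)).card := by
    intro n
    rw [← Finset.card_powersetCard]
    congr 1
    ext J
    simp only [Finset.mem_powersetCard, Finset.mem_filter, mem_primeGap, Finset.subset_iff]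
    constructor
    · rintro ⟨h1, h2⟩
      exact ⟨⟨fun x hx => (h1 hx).1, h2⟩, fun h hh => (h1 hh).2⟩
    · rintro ⟨⟨h1, h2⟩, h3⟩
      exact ⟨fun x hx => ⟨h1 hx, h3 x hx⟩, h2⟩
  have h2 : ∀ J : Finset ℤ, tupleCount x (pairSet d ∪ J) =
      ((tuplePoints x (pairSet d)).filter fun n : ℕ => ∀ h ∈ J, IsPositivePrime (n + h)).card := by
    intro J
    rw [tupleCount_eq_card]
    congr 1
    ext n
    simp only [mem_tuplePoints, Finset.mem_filter, Finset.forall_mem_union, and_assoc]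
  simp only [h1, h2, Finset.card_filter]
  exact Finset.sum_comm

open Classical in
/-- The positive integers `n ≤ x` such that `n + 1` and `n + 1 + d` are consecutive primes. -/
noncomputable def consecutivePoints (x : ℝ) (d : ℕ) : Finset ℕ :=
  (tuplePoints x (pairSet d)).filter fun n => (primeGap d n).card = 0

lemma abs_card_consecutivePoints_sub_le (x : ℝ) (d m : ℕ) :
    |((consecutivePoints x d).card : ℝ) - ∑ j ∈ Finset.range m, (-1) ^ j *
        ∑ J ∈ (gap d).powersetCard j, (tupleCount x (pairSet d ∪ J) : ℝ)| ≤
      ∑ J ∈ (gap d).powersetCard m, (tupleCount x (pairSet d ∪ J) : ℝ) := by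
  have h : ∀ j, ∑ J ∈ (gap d).powersetCard j, (tupleCount x (pairSet d ∪ J) : ℝ) =
      ∑ n ∈ tuplePoints x (pairSet d), ((primeGap d n).card.choose j : ℝ) := fun j => by
    exact_mod_cast sum_tupleCount_eq x d j
  simp only [h]
  rw [consecutivePoints, Finset.card_filter]
  push_cast
  simp only [Finset.mul_sum]
  rw [Finset.sum_comm, ← Finset.sum_sub_distrib]
  exact (Finset.abs_sum_le_sum_abs _ _).trans
    (Finset.sum_le_sum fun n _ => abs_indicator_sub_alternating_sum_le _ m)

lemma isPositivePrime_natCast {n : ℕ} : IsPositivePrime (n : ℤ) ↔ n.Prime := by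
  constructor
  · rintro ⟨p, hp, h⟩
    rwa [Int.natCast_inj.1 h]
  · exact fun h => ⟨n, h, rfl⟩

lemma mem_consecutivePoints {x : ℝ} {d n : ℕ} :
    n ∈ consecutivePoints x d ↔ (1 ≤ n ∧ n ≤ ⌊x⌋₊) ∧ (n + 1).Prime ∧ (n + 1 + d).Prime ∧
      ∀ q : ℕ, n + 1 < q → q < n + 1 + d → ¬ q.Prime := by
  rw [consecutivePoints, Finset.mem_filter, mem_tuplePoints, Finset.card_eq_zero,
    Finset.eq_empty_iff_forall_notMem, and_assoc, and_congr_right_iff]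
  intro _
  simp only [mem_primeGap, not_and]
  rw [← and_assoc]
  refine and_congr ?_ ?_
  · simp only [mem_pairSet, forall_eq_or_imp, forall_eq]
    rw [← isPositivePrime_natCast, ← isPositivePrime_natCast]
    push_cast
    rw [show (n : ℤ) + 1 + d = n + (d + 1) by ring]
  · constructor
    · intro h q h1 h2 hq
      refine h ((q : ℤ) - n) (mem_gap.2 ⟨by omega, by omega⟩) ⟨q, hq, by ring⟩
    · rintro h z hz ⟨q, hq, he⟩
      rw [mem_gap] at hz
      exact h q (by omega) (by omega) hq

lemma consecutiveCount_le (x : ℝ) (d : ℕ) :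
    consecutiveCount x d ≤ (consecutivePoints x d).card := by
  rw [consecutiveCount, ← Set.ncard_coe_finset]
  have hmono := strictMono_nth_prime
  have hpos : ∀ n, 1 < Nat.nth Nat.Prime n := fun n => (Nat.prime_nth_prime n).one_lt
  refine Set.ncard_le_ncard_of_injOn (fun n => Nat.nth Nat.Prime n - 1) ?_ ?_
    (Finset.finite_toSet _)
  · rintro n ⟨h1, h2⟩
    have h0 := hpos n
    have hlt : Nat.nth Nat.Prime n < Nat.nth Nat.Prime (n + 1) := hmono (Nat.lt_succ_self n)
    rw [Finset.mem_coe, mem_consecutivePoints]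
    have e1 : Nat.nth Nat.Prime n - 1 + 1 = Nat.nth Nat.Prime n := by omega
    have e2 : Nat.nth Nat.Prime n + d = Nat.nth Nat.Prime (n + 1) := by omega
    rw [e1, e2]
    refine ⟨⟨by omega, ?_⟩, Nat.prime_nth_prime n, Nat.prime_nth_prime (n + 1), ?_⟩
    · have : Nat.nth Nat.Prime (n + 1) ≤ ⌊x⌋₊ :=
        (Nat.le_floor_iff' (by have := hpos (n + 1); omega)).2 h1
      omega
    · intro q hq1 hq2 hq
      rw [← Nat.nth_count hq, hmono.lt_iff_lt] at hq1 hq2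
      omega
  · intro a _ b _ hab
    beta_reduce at hab
    have ha := hpos a
    have hb := hpos b
    exact hmono.injective (by omega)

/-- `consecutivePoints` bounds `n` by `x`, `consecutiveCount` bounds the larger prime `n + 1 + d`.
They differ only for `n` among the last `d + 1` integers up to `x`. -/
lemma card_consecutivePoints_le (x : ℝ) {d : ℕ} (hd : 0 < d) :
    (consecutivePoints x d).card ≤ consecutiveCount x d + (d + 1) := by
  classical
  have hmono := strictMono_nth_prime
  rw [← Finset.card_filter_add_card_filter_not (s := consecutivePoints x d)
    (fun n => n + 1 + d ≤ ⌊x⌋₊)]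
  refine Nat.add_le_add ?_ ?_
  · rw [consecutiveCount, ← Set.ncard_coe_finset]
    refine Set.ncard_le_ncard_of_injOn (fun n => Nat.count Nat.Prime (n + 1)) ?_ ?_ ?_
    · intro n hn
      rw [Finset.mem_coe, Finset.mem_filter, mem_consecutivePoints] at hn
      obtain ⟨⟨-, h1, h2, h3⟩, h4⟩ := hn
      have e1 : Nat.nth Nat.Prime (Nat.count Nat.Prime (n + 1)) = n + 1 := Nat.nth_count h1
      have e2 : Nat.nth Nat.Prime (Nat.count Nat.Prime (n + 1) + 1) = n + 1 + d := by
        have hgt : n + 1 < Nat.nth Nat.Prime (Nat.count Nat.Prime (n + 1) + 1) := by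
          conv_lhs => rw [← e1]
          exact hmono (Nat.lt_succ_self _)
        have hle : Nat.nth Nat.Prime (Nat.count Nat.Prime (n + 1) + 1) ≤ n + 1 + d := by
          conv_rhs => rw [← Nat.nth_count h2]
          rw [hmono.le_iff_le, Nat.succ_le_iff, ← hmono.lt_iff_lt, e1, Nat.nth_count h2]
          omega
        by_contra hne
        exact h3 _ hgt (lt_of_le_of_ne hle hne) (Nat.prime_nth_prime _)
      refine ⟨?_, ?_⟩
      · rw [e2]
        exact (Nat.le_floor_iff' (by omega)).1 h4
      · rw [e2, e1]
        push_cast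
        ring
    · intro a ha b hb hab
      rw [Finset.mem_coe, Finset.mem_filter, mem_consecutivePoints] at ha hb
      have := congrArg (Nat.nth Nat.Prime) hab
      beta_reduce at this
      rw [Nat.nth_count ha.1.2.1, Nat.nth_count hb.1.2.1] at this
      omega
    -- Finiteness is essential, since `Set.ncard` of an infinite set is `0`.
    · refine (Set.finite_Iic ⌊x⌋₊).subset ?_
      rintro n ⟨h1, -⟩
      have h2 : Nat.nth Nat.Prime (n + 1) ≤ ⌊x⌋₊ :=
        (Nat.le_floor_iff' (Nat.prime_nth_prime (n + 1)).ne_zero).2 h1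
      have h3 := hmono.le_apply (x := n + 1)
      rw [Set.mem_Iic]
      omega
  · have hsub : (consecutivePoints x d).filter (fun n => ¬ n + 1 + d ≤ ⌊x⌋₊) ⊆
        Finset.Ioc (⌊x⌋₊ - (d + 1)) ⌊x⌋₊ := by
      intro n hn
      rw [Finset.mem_filter, mem_consecutivePoints] at hn
      rw [Finset.mem_Ioc]
      omega
    refine (Finset.card_le_card hsub).trans ?_
    rw [Nat.card_Ioc]
    omega

/-! ### Conjecture H and the passage to the limit -/

/-- The sum of `tupleCount` over the sets `pairSet d ∪ J` with `J` a `j`-element subset of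
`gap d`. -/
noncomputable def tupleCountSum (x : ℝ) (d j : ℕ) : ℝ :=
  ∑ J ∈ (gap d).powersetCard j, (tupleCount x (pairSet d ∪ J) : ℝ)

/-- The sum of the singular series over the sets `pairSet d ∪ J` with `J` a `j`-element subset
of `gap d`. -/
noncomputable def singularSeriesSum (d j : ℕ) : ℝ :=
  ∑ J ∈ (gap d).powersetCard j, tupleSingularSeries (pairSet d ∪ J)

/-- The conjectural number of prime pairs `n, n + d` with `n ≤ x`. -/
noncomputable def pairMainTerm (x : ℝ) (d : ℕ) : ℝ := pairSingularSeries d * (x / Real.log x ^ 2)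

lemma tendsto_singularSeriesSum_div (j : ℕ) {d : ℝ → ℕ} (hd : Tendsto d atTop atTop)
    (he : ∀ᶠ x : ℝ in atTop, Even (d x)) :
    Tendsto (fun x => singularSeriesSum (d x) j / (pairSingularSeries (d x) * (d x : ℝ) ^ j)) atTop
      (𝓝 (1 / j.factorial)) := by
  rw [Metric.tendsto_nhds]
  intro ε hε
  filter_upwards [hd.eventually (eventually_abs_sum_tupleSingularSeries_sub_le j (half_pos hε)),
    hd.eventually_gt_atTop 0, he] with x hx h0 hev
  have h := hx hev
  rw [← pairSingularSeries_eq h0 hev] at h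
  have hS := one_le_pairSingularSeries hev
  have hpos : 0 < pairSingularSeries (d x) * (d x : ℝ) ^ j :=
    mul_pos (by linarith) (pow_pos (by exact_mod_cast h0) j)
  have heq : singularSeriesSum (d x) j / (pairSingularSeries (d x) * (d x : ℝ) ^ j) -
      1 / j.factorial = (singularSeriesSum (d x) j -
        pairSingularSeries (d x) * ((d x : ℝ) ^ j / j.factorial)) /
        (pairSingularSeries (d x) * (d x : ℝ) ^ j) := by
    rw [sub_div]
    congr 1
    rw [mul_div_assoc', div_right_comm, div_self hpos.ne']
  rw [Real.dist_eq, heq, abs_div, abs_of_pos hpos, div_lt_iff₀ hpos]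
  exact h.trans_lt (mul_lt_mul_of_pos_right (half_lt_self hε) hpos)

lemma tendsto_div_log {lam : ℝ} (hlam : 0 < lam) {d : ℝ → ℕ}
    (hd : (fun x : ℝ => (d x : ℝ)) ~[atTop] (fun x : ℝ => lam * Real.log x)) :
    Tendsto (fun x => (d x : ℝ) / Real.log x) atTop (𝓝 lam) := by
  have hlog : ∀ᶠ x : ℝ in atTop, 0 < Real.log x := Real.tendsto_log_atTop.eventually_gt_atTop 0
  have h := (isEquivalent_iff_tendsto_one (hlog.mono fun x hx => (mul_pos hlam hx).ne')).1 hd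
  have h2 := h.const_mul lam
  rw [mul_one] at h2
  refine h2.congr' (hlog.mono fun x hx => ?_)
  simp only [Pi.div_apply]
  field_simp

lemma tendsto_atTop_of_isEquivalent_log {lam : ℝ} (hlam : 0 < lam) {d : ℝ → ℕ}
    (hd : (fun x : ℝ => (d x : ℝ)) ~[atTop] (fun x : ℝ => lam * Real.log x)) :
    Tendsto d atTop atTop :=
  tendsto_natCast_atTop_iff.1
    (hd.symm.tendsto_atTop (Real.tendsto_log_atTop.const_mul_atTop hlam))

lemma eventually_pairMainTerm_ge {d : ℝ → ℕ} (he : ∀ᶠ x : ℝ in atTop, Even (d x)) :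
    ∀ᶠ x : ℝ in atTop, 0 < x / Real.log x ^ 2 ∧ x / Real.log x ^ 2 ≤ pairMainTerm x (d x) := by
  filter_upwards [he, Real.tendsto_log_atTop.eventually_gt_atTop 0, eventually_gt_atTop 0]
    with x hx hl h0
  have hpos : 0 < x / Real.log x ^ 2 := by positivity
  exact ⟨hpos, le_mul_of_one_le_left hpos.le (one_le_pairSingularSeries hx)⟩

lemma tendsto_pow_div_pairMainTerm {lam : ℝ} {d : ℝ → ℕ}
    (hd : Tendsto (fun x => (d x : ℝ) / Real.log x) atTop (𝓝 lam))
    (he : ∀ᶠ x : ℝ in atTop, Even (d x)) (j : ℕ) :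
    Tendsto (fun x => (d x : ℝ) ^ j / pairMainTerm x (d x)) atTop (𝓝 0) := by
  have h1 : Tendsto (fun x : ℝ => Real.log x ^ (j + 2) / x) atTop (𝓝 0) :=
    Real.isLittleO_pow_log_id_atTop.tendsto_div_nhds_zero
  have h2 := (hd.pow j).mul h1
  rw [mul_zero] at h2
  refine tendsto_of_tendsto_of_tendsto_of_le_of_le' tendsto_const_nhds h2 ?_ ?_
  · filter_upwards [eventually_pairMainTerm_ge he] with x hx
    exact div_nonneg (by positivity) (hx.1.le.trans hx.2)
  · filter_upwards [eventually_pairMainTerm_ge he,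
      Real.tendsto_log_atTop.eventually_gt_atTop 0, eventually_gt_atTop 0] with x hx hl h0
    calc (d x : ℝ) ^ j / pairMainTerm x (d x) ≤ (d x : ℝ) ^ j / (x / Real.log x ^ 2) :=
          div_le_div_of_nonneg_left (by positivity) hx.1 hx.2
      _ = _ := by rw [div_pow, pow_add]; field_simp

lemma eventually_abs_tupleCountSum_sub_le (hH : ConjectureH) {lam : ℝ} (hlam : 0 < lam)
    {d : ℝ → ℕ} (hd : (fun x : ℝ => (d x : ℝ)) ~[atTop] (fun x : ℝ => lam * Real.log x))
    (j : ℕ) {ε : ℝ} (hε : 0 < ε) :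
    ∀ᶠ x : ℝ in atTop,
      |tupleCountSum x (d x) j - singularSeriesSum (d x) j * (x / Real.log x ^ (j + 2))| ≤
        ε * (singularSeriesSum (d x) j * (x / Real.log x ^ (j + 2))) +
          (j + 2) * (d x : ℝ) ^ j := by
  have hconst : (fun _ : ℝ => (1 : ℝ)) =o[atTop] (fun x : ℝ => lam * Real.log x) :=
    isLittleO_const_left.2 (Or.inr (tendsto_norm_atTop_atTop.comp
      (Real.tendsto_log_atTop.const_mul_atTop hlam)))
  -- All the sets lie in `[1, d + 1]`, so Conjecture H is applied with `h = d + 1`. Inadmissible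
  -- sets have singular series `0` and add at most `j + 2` each.
  have hh : (fun x : ℝ => (d x : ℝ) + 1) ~[atTop] (fun x : ℝ => lam * Real.log x) :=
    hd.add_isLittleO hconst
  filter_upwards [hH (j + 2) (by omega) lam hlam _ hh ε hε,
    (tendsto_atTop_of_isEquivalent_log hlam hd).eventually_gt_atTop 0,
    eventually_ge_atTop 1] with x hx hd0 hx1
  have hX : 0 ≤ x / Real.log x ^ (j + 2) :=
    div_nonneg (by linarith) (pow_nonneg (Real.log_nonneg hx1) _)
  set X := x / Real.log x ^ (j + 2)
  have hterm : ∀ J ∈ (gap (d x)).powersetCard j,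
      |(tupleCount x (pairSet (d x) ∪ J) : ℝ) - tupleSingularSeries (pairSet (d x) ∪ J) * X| ≤
        ε * (tupleSingularSeries (pairSet (d x) ∪ J) * X) + (j + 2) := by
    intro J hJ
    have hcard := card_pairSet_union hd0 hJ
    have hmem : ∀ a ∈ pairSet (d x) ∪ J, 1 ≤ a ∧ a ≤ d x + 1 := by
      intro a ha
      rcases Finset.mem_union.1 ha with h | h
      · rw [mem_pairSet] at h; omega
      · have := mem_gap.1 ((Finset.mem_powersetCard.1 hJ).1 h); omega
    by_cases hadm : Admissible (pairSet (d x) ∪ J)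
    · have := hx _ hcard hadm fun a ha => ⟨(hmem a ha).1, by exact_mod_cast (hmem a ha).2⟩
      have hj : (0 : ℝ) ≤ j := Nat.cast_nonneg j
      linarith
    · have h := tupleCount_le_of_not_admissible hadm (fun a ha => (hmem a ha).1) x
      rw [hcard] at h
      rw [tupleSingularSeries_eq_zero_of_not_admissible hadm]
      simp only [zero_mul, sub_zero, mul_zero, zero_add, Nat.abs_cast]
      exact_mod_cast h
  have hcardJ : (((gap (d x)).powersetCard j).card : ℝ) ≤ (d x : ℝ) ^ j := by
    rw [Finset.card_powersetCard, card_gap]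
    exact_mod_cast (Nat.choose_le_pow _ _).trans (Nat.pow_le_pow_left (Nat.sub_le _ _) j)
  rw [tupleCountSum, singularSeriesSum, Finset.sum_mul, ← Finset.sum_sub_distrib]
  refine (Finset.abs_sum_le_sum_abs _ _).trans ((Finset.sum_le_sum hterm).trans ?_)
  rw [Finset.sum_add_distrib, ← Finset.mul_sum, Finset.sum_const, nsmul_eq_mul,
    mul_comm (_ : ℝ) ((j : ℝ) + 2)]
  exact add_le_add_right (mul_le_mul_of_nonneg_left hcardJ (by positivity)) _

lemma tendsto_tupleCountSum_div (hH : ConjectureH) {lam : ℝ} (hlam : 0 < lam) {d : ℝ → ℕ}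
    (he : ∀ᶠ x : ℝ in atTop, Even (d x))
    (hd : (fun x : ℝ => (d x : ℝ)) ~[atTop] (fun x : ℝ => lam * Real.log x)) (j : ℕ) :
    Tendsto (fun x => tupleCountSum x (d x) j / pairMainTerm x (d x)) atTop
      (𝓝 (lam ^ j / j.factorial)) := by
  have hdlog := tendsto_div_log hlam hd
  have hdtop := tendsto_atTop_of_isEquivalent_log hlam hd
  set L := lam ^ j / (j.factorial : ℝ) with hL
  have hL0 : 0 ≤ L := by positivity
  set M : ℝ → ℝ := fun x =>
    singularSeriesSum (d x) j * (x / Real.log x ^ (j + 2)) / pairMainTerm x (d x)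
  have hM : Tendsto M atTop (𝓝 L) := by
    have h := (tendsto_singularSeriesSum_div j hdtop he).mul (hdlog.pow j)
    rw [one_div_mul_eq_div] at h
    refine h.congr' ?_
    filter_upwards [hdtop.eventually_gt_atTop 0, he, eventually_gt_atTop 0,
      Real.tendsto_log_atTop.eventually_gt_atTop 0] with x hd0 hev hx0 hl
    have h1 : (d x : ℝ) ≠ 0 := by exact_mod_cast hd0.ne'
    have h2 : pairSingularSeries (d x) ≠ 0 := by linarith [one_le_pairSingularSeries hev]
    simp only [M, pairMainTerm, pow_add, div_pow]
    field_simp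
  have hdiff : Tendsto (fun x => tupleCountSum x (d x) j / pairMainTerm x (d x) - M x) atTop
      (𝓝 0) := by
    rw [Metric.tendsto_nhds]
    intro ε hε
    -- Eventually `M x < L + 1`, so the relative error from Conjecture H stays below `ε / 2`.
    set δ := ε / (2 * (L + 1)) with hδ
    have hδ0 : 0 < δ := by positivity
    have herr := (tendsto_pow_div_pairMainTerm hdlog he j).const_mul ((j : ℝ) + 2)
    rw [mul_zero] at herr
    filter_upwards [eventually_abs_tupleCountSum_sub_le hH hlam hd j hδ0,
      eventually_pairMainTerm_ge he, hM.eventually_lt_const (lt_add_one L),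
      herr.eventually_lt_const (half_pos hε)] with x h1 h2 h3 h4
    have hQ := h2.1.trans_le h2.2
    have h5 := div_le_div_of_nonneg_right h1 hQ.le
    rw [add_div, mul_div_assoc δ, mul_div_assoc ((j : ℝ) + 2)] at h5
    have h6 : δ * M x < ε / 2 := by
      calc δ * M x < δ * (L + 1) := mul_lt_mul_of_pos_left h3 hδ0
        _ = ε / 2 := by rw [hδ]; field_simp
    rw [Real.dist_eq, sub_zero, ← sub_div, abs_div, abs_of_pos hQ]
    exact h5.trans_lt (by linarith)
  simpa using hdiff.add hM

lemma tendsto_card_consecutivePoints_div (hH : ConjectureH) {lam : ℝ} (hlam : 0 < lam)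
    {d : ℝ → ℕ} (he : ∀ᶠ x : ℝ in atTop, Even (d x))
    (hd : (fun x : ℝ => (d x : ℝ)) ~[atTop] (fun x : ℝ => lam * Real.log x)) :
    Tendsto (fun x => ((consecutivePoints x (d x)).card : ℝ) / pairMainTerm x (d x)) atTop
      (𝓝 (Real.exp (-lam))) := by
  rw [Metric.tendsto_nhds]
  intro ε hε
  have hexp : Tendsto (fun m : ℕ => ∑ j ∈ Finset.range m, (-lam) ^ j / (j.factorial : ℝ)) atTop
      (𝓝 (Real.exp (-lam))) := by
    rw [Real.exp_eq_exp_ℝ]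
    exact (NormedSpace.expSeries_div_hasSum_exp (-lam)).tendsto_sum_nat
  -- One `m` serves twice: the exponential series is truncated there, and the Bonferroni error tends
  -- to `λ^m / m!`.
  obtain ⟨m, hm1, hm2⟩ := ((Metric.tendsto_nhds.1 hexp (ε / 4) (by positivity)).and
    ((FloorSemiring.tendsto_pow_div_factorial_atTop lam).eventually_lt_const
      (show (0 : ℝ) < ε / 4 by positivity))).exists
  have hT := tendsto_tupleCountSum_div hH hlam he hd
  have hsum : Tendsto (fun x => ∑ j ∈ Finset.range m,
      (-1) ^ j * (tupleCountSum x (d x) j / pairMainTerm x (d x))) atTop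
      (𝓝 (∑ j ∈ Finset.range m, (-lam) ^ j / (j.factorial : ℝ))) := by
    refine tendsto_finsetSum _ fun j _ => ?_
    have h := (hT j).const_mul ((-1) ^ j)
    rwa [mul_div_assoc', ← mul_pow, neg_one_mul] at h
  filter_upwards [Metric.tendsto_nhds.1 hsum (ε / 4) (by positivity),
    (hT m).eventually_lt_const hm2, eventually_pairMainTerm_ge he] with x h1 h2 h3
  have hQ := h3.1.trans_le h3.2
  have h4 := div_le_div_of_nonneg_right (abs_card_consecutivePoints_sub_le x (d x) m) hQ.le
  rw [← abs_of_pos hQ, ← abs_div, abs_of_pos hQ, sub_div, Finset.sum_div] at h4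
  simp only [mul_div_assoc] at h4
  change |_ - ∑ j ∈ Finset.range m, (-1) ^ j * (tupleCountSum x (d x) j / _)| ≤
    tupleCountSum x (d x) m / _ at h4
  rw [Real.dist_eq, abs_lt] at h1 hm1 ⊢
  rw [abs_le] at h4
  constructor <;> linarith

lemma tendsto_consecutiveCount_div (hH : ConjectureH) {lam : ℝ} (hlam : 0 < lam)
    {d : ℝ → ℕ} (he : ∀ᶠ x : ℝ in atTop, Even (d x))
    (hd : (fun x : ℝ => (d x : ℝ)) ~[atTop] (fun x : ℝ => lam * Real.log x)) :
    Tendsto (fun x => (consecutiveCount x (d x) : ℝ) / pairMainTerm x (d x)) atTop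
      (𝓝 (Real.exp (-lam))) := by
  have hE := tendsto_card_consecutivePoints_div hH hlam he hd
  have hdlog := tendsto_div_log hlam hd
  -- The discrepancy `d + 1` between the two counts is written as `d^1 + d^0`.
  have h1 := (tendsto_pow_div_pairMainTerm hdlog he 1).add (tendsto_pow_div_pairMainTerm hdlog he 0)
  have hlow := hE.sub h1
  rw [add_zero, sub_zero] at hlow
  refine tendsto_of_tendsto_of_tendsto_of_le_of_le' hlow hE ?_ ?_
  · filter_upwards [eventually_pairMainTerm_ge he,
      (tendsto_atTop_of_isEquivalent_log hlam hd).eventually_gt_atTop 0] with x hx hd0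
    have h : ((consecutivePoints x (d x)).card : ℝ) ≤
        consecutiveCount x (d x) + (d x + 1) := by
      exact_mod_cast card_consecutivePoints_le x hd0
    rw [← add_div, ← sub_div, pow_one, pow_zero]
    exact div_le_div_of_nonneg_right (by linarith) (hx.1.le.trans hx.2)
  · filter_upwards [eventually_pairMainTerm_ge he] with x hx
    exact div_le_div_of_nonneg_right (by exact_mod_cast consecutiveCount_le x (d x))
      (hx.1.le.trans hx.2)

end PrimeTuples

theorem mainTheorem1 (hH : PrimeTuples.ConjectureH)
    (lam : ℝ) (hlam : 0 < lam) (d : ℝ → ℕ)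
    (hd_even : ∀ᶠ x : ℝ in atTop, Even (d x))
    (hd : (fun x : ℝ => (d x : ℝ)) ~[atTop] (fun x : ℝ => lam * Real.log x)) :
    (fun x : ℝ => (PrimeTuples.consecutiveCount x (d x) : ℝ)) ~[atTop]
      (fun x : ℝ => Real.exp (-lam) * PrimeTuples.pairSingularSeries (d x) *
        (x / Real.log x ^ 2)) := by
  refine isEquivalent_of_tendsto_one ?_
  have h := (PrimeTuples.tendsto_consecutiveCount_div hH hlam hd_even hd).div_const
    (Real.exp (-lam))
  rw [div_self (Real.exp_pos _).ne'] at h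
  refine h.congr fun x => ?_
  rw [Pi.div_apply, PrimeTuples.pairMainTerm, div_div]
  congr 1
  ring
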